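/- Let $L:\mathbb{T}^d\to\mathbb{T}^d$ be a linear Anosov automorphism, i.e. induced by a matrix in $GL(d,\mathbb{Z})$ without eigenvalues of modulus one, diagonalizable over $\mathbb{R}$, with eigenvalues $\beta_1,\dots,\beta_d\in\mathbb{R}$ of pairwise distinct absolute values, $|\beta_1|<\dots<|\beta_d|$. There is $\delta>0$, depending only on $L$, such that the following holds for every $\alpha\in(0,1]$ and every $C^{1+\alpha}$ Anosov diffeomorphism $f:\mathbb{T}^d\to\mathbb{T}^d$ such that $d(f(x),L(x))<\delta$ and $\|Df(x)-L\|<\delta$ for all $x$. Suppose that $f$ has constant periodic data: whenever $f^\tau(p)=p$ and $f^\tau(q)=q$ for an integer $\tau$, the linear maps $Df^\tau(p)$ and $Df^\tau(q)$ are conjugate. Then every point $x\in\mathbb{T}^d$ is regular in the sense of Oseledets: $T_x\mathbb{T}^d$ is a direct sum of nonzero subspaces $V_1,\dots,V_r$ for which there are numbers $\chi_1<\dots<\chi_r$ with $\lim_{n\to\pm\infty}\frac1n\log\|Df^n(x)v\|=\chi_j$ for all $0\ne v\in V_j$ and $\lim_{n\to\pm\infty}\frac1n\log|\det Df^n(x)|=\sum_j\chi_j\dim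 V_j$. More precisely, there are continuous $Df$-invariant line bundles $E_1,\dots,E_d$ and numbers $\lambda_1<\dots<\lambda_d$, the same for all points, such that at every $x$ the lines $E_i(x)$ and the numbers $\lambda_i$ form such a splitting; $\lambda_i<0$ if and only if $|\beta_i|<1$, and $\lambda_i>0$ if and only if $|\beta_i|>1$; the stable bundle of $f$ is $E^s_f=\bigoplus_{\lambda_i<0}E_i$ and the unstable bundle is $E^u_f=\bigoplus_{\lambda_i>0}E_i$. In particular the Lyapunov exponent of $f$ at any point $x$ along $E_i$ equals the exponent along $E_i$ at any periodic point $p$. Moreover, the limits converge uniformly: as $|n|\to\infty$, $\frac1n\log\|Df^n(x)v\|\to\lambda_i$ uniformly in $x$ and in unit vectors $v\in E_i(x)$, and for every $I\subseteq\{1,\dots,d\}$, $\frac1n\log\mathrm{Jac}\big(Df^n(x)|_{\bigoplus_{i\in I}E_i(x)}\big)\to\sum_{i\in I}\lambda_i$ uniformly in $x$. -/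

import Mathlib

open Filter Topology
open scoped NNReal

noncomputable section

namespace TorusAnosov

/-- The torus `𝕋ᵈ = ℝᵈ / ℤᵈ`. -/
abbrev Torus (d : ℕ) : Type := UnitAddTorus (Fin d)

/-- The tangent space of `𝕋ᵈ` (the tangent bundle is trivialised by translations), with the
Euclidean norm. -/
abbrev Vec (d : ℕ) : Type := EuclideanSpace ℝ (Fin d)

/-- The covering projection `ℝᵈ → 𝕋ᵈ`. -/
def proj {d : ℕ} (v : Vec d) : Torus d := fun i => ((v i : ℝ) : UnitAddCircle)

/-- `f : 𝕋ᵈ → 𝕋ᵈ` is differentiable at `x` with derivative `A`: in the charts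
`v ↦ x + proj v` and `w ↦ f x + proj w` it is given near `0` by a map `g` fixing `0`,
with derivative `A` at `0`. -/
def HasTorusFDerivAt {d : ℕ} (f : Torus d → Torus d) (A : Vec d →L[ℝ] Vec d) (x : Torus d) :
    Prop :=
  ∃ g : Vec d → Vec d, g 0 = 0 ∧ HasFDerivAt g A 0 ∧
    ∀ᶠ v in 𝓝 (0 : Vec d), f (x + proj v) = f x + proj (g v)

open Classical in
/-- The derivative `Df(x)` (zero where `f` is not differentiable). -/
def tderiv {d : ℕ} (f : Torus d → Torus d) (x : Torus d) : Vec d →L[ℝ] Vec d :=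
  if h : ∃ A, HasTorusFDerivAt f A x then h.choose else 0

/-- Maps of class `C^{1+α}`: differentiable everywhere, with `α`-Hölder derivative. -/
def IsC1Holder {d : ℕ} (α : ℝ≥0) (f : Torus d → Torus d) : Prop :=
  (∀ x, ∃ A, HasTorusFDerivAt f A x) ∧ ∃ K : ℝ≥0, HolderWith K α (tderiv f)

/-- `C^{1+α}` diffeomorphisms of the torus. -/
def IsC1HolderDiffeo {d : ℕ} (α : ℝ≥0) (f : Torus d ≃ₜ Torus d) : Prop :=
  IsC1Holder α f ∧ IsC1Holder α f.symm

/-- `Dfⁿ(x)` for `n ∈ ℤ`. -/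
def Dpow {d : ℕ} (f : Torus d ≃ₜ Torus d) (n : ℤ) (x : Torus d) : Vec d →L[ℝ] Vec d :=
  tderiv (⇑(f ^ n)) x

/-- Continuity of a field of tangent subspaces: the orthogonal projection onto the subspace
depends continuously on the point. -/
def ContinuousField {d : ℕ} (V : Torus d → Submodule ℝ (Vec d)) : Prop :=
  Continuous fun x => (V x).starProjection

/-- Invariance under the derivative: `Df(x) V(x) = V(f x)`. -/
def InvariantField {d : ℕ} (f : Torus d ≃ₜ Torus d) (V : Torus d → Submodule ℝ (Vec d)) : Prop :=
  ∀ x, (V x).map (tderiv f x : Vec d →ₗ[ℝ] Vec d) = V (f x)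

/-- `T𝕋ᵈ = E^s ⊕ E^u` is a hyperbolic splitting for `f`. -/
structure IsHyperbolicSplitting {d : ℕ} (f : Torus d ≃ₜ Torus d)
    (Es Eu : Torus d → Submodule ℝ (Vec d)) : Prop where
  isCompl : ∀ x, IsCompl (Es x) (Eu x)
  continuous_stable : ContinuousField Es
  continuous_unstable : ContinuousField Eu
  invariant_stable : InvariantField f Es
  invariant_unstable : InvariantField f Eu
  rates : ∃ θ η C : ℝ, 0 < θ ∧ θ < 1 ∧ 1 < η ∧ 0 < C ∧ ∀ (n : ℕ) (x : Torus d),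
    (∀ v ∈ Eu x, C⁻¹ * η ^ n * ‖v‖ ≤ ‖Dpow f n x v‖) ∧
    (∀ v ∈ Es x, ‖Dpow f n x v‖ ≤ C * θ ^ n * ‖v‖)

/-- `f` is an Anosov diffeomorphism (its smoothness is stated separately). -/
def IsAnosov {d : ℕ} (f : Torus d ≃ₜ Torus d) : Prop :=
  ∃ Es Eu, IsHyperbolicSplitting f Es Eu

/-- Constant periodic data: `Df^τ(p)` and `Df^τ(q)` are conjugate whenever `f^τ` fixes `p`
and `q`. -/
def HasConstantPeriodicData {d : ℕ} (f : Torus d ≃ₜ Torus d) : Prop :=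
  ∀ (p q : Torus d) (τ : ℤ), (f ^ τ) p = p → (f ^ τ) q = q →
    ∃ S : Vec d ≃L[ℝ] Vec d, ∀ v, S (Dpow f τ p v) = Dpow f τ q (S v)

/-- The real matrix of an integer matrix. -/
def realMatrix {d : ℕ} (M : Matrix (Fin d) (Fin d) ℤ) : Matrix (Fin d) (Fin d) ℝ :=
  M.map (fun a : ℤ => (a : ℝ))

/-- The endomorphism of the torus induced by an integer matrix. -/
def linMap {d : ℕ} (M : Matrix (Fin d) (Fin d) ℤ) (x : Torus d) : Torus d :=
  fun i => ∑ j, M i j • x j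

/-- `M` induces a linear Anosov automorphism: it is invertible over `ℤ` and has no complex
eigenvalue of modulus one. -/
def IsAnosovMatrix {d : ℕ} (M : Matrix (Fin d) (Fin d) ℤ) : Prop :=
  IsUnit M.det ∧ ∀ μ ∈ spectrum ℂ (M.map (fun a : ℤ => (a : ℂ))), ‖μ‖ ≠ 1

/-- `f` is `δ`-close to the linear map induced by `M` in the `C¹` distance. -/
def C1Close {d : ℕ} (δ : ℝ) (f : Torus d ≃ₜ Torus d) (M : Matrix (Fin d) (Fin d) ℤ) : Prop :=
  ∀ x, dist (f x) (linMap M x) < δ ∧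
    ‖tderiv f x - Matrix.toEuclideanCLM (n := Fin d) (𝕜 := ℝ) (realMatrix M)‖ < δ

/-- `(1/n) log ‖Dfⁿ(x) v‖`. -/
def growth {d : ℕ} (f : Torus d ≃ₜ Torus d) (x : Torus d) (v : Vec d) (n : ℤ) : ℝ :=
  (1 / (n : ℝ)) * Real.log ‖Dpow f n x v‖

/-- The Lyapunov exponent of `f` at `x` in the direction `v` exists, as a two-sided limit, and
equals `χ`. -/
def HasLyapunovExponent {d : ℕ} (f : Torus d ≃ₜ Torus d) (x : Torus d) (v : Vec d) (χ : ℝ) :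
    Prop :=
  Tendsto (growth f x v) atTop (𝓝 χ) ∧ Tendsto (growth f x v) atBot (𝓝 χ)

/-- The Oseledets splitting at `x`: `T_x = ⨁ V j`, every nonzero vector of `V j` has the exponent
`χ j`, the `χ j` are distinct, and `(1/n) log |det Dfⁿ(x)|` tends to the sum of the exponents,
counted with multiplicity, as `n → ±∞`. -/
structure IsOseledetsSplitting {d : ℕ} (f : Torus d ≃ₜ Torus d) (x : Torus d) {r : ℕ}
    (χ : Fin r → ℝ) (V : Fin r → Submodule ℝ (Vec d)) : Prop where
  strictMono : StrictMono χ
  ne_bot : ∀ j, V j ≠ ⊥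
  isInternal : DirectSum.IsInternal V
  exponent : ∀ j, ∀ v ∈ V j, v ≠ 0 → HasLyapunovExponent f x v (χ j)
  det_atTop : Tendsto (fun n : ℤ => (1 / (n : ℝ)) * Real.log |(Dpow f n x).det|) atTop
    (𝓝 (∑ j, (Module.finrank ℝ (V j) : ℝ) * χ j))
  det_atBot : Tendsto (fun n : ℤ => (1 / (n : ℝ)) * Real.log |(Dpow f n x).det|) atBot
    (𝓝 (∑ j, (Module.finrank ℝ (V j) : ℝ) * χ j))

/-- Regular points, in the sense of Oseledets' theorem. -/
def IsRegularPoint {d : ℕ} (f : Torus d ≃ₜ Torus d) (x : Torus d) : Prop :=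
  ∃ (r : ℕ) (χ : Fin r → ℝ) (V : Fin r → Submodule ℝ (Vec d)), IsOseledetsSplitting f x χ V

/-- The Jacobian (volume distortion) of `A` restricted to the subspace `V`, that is
`√(det (BᵀB))` for `B = A|_V`. -/
def subJac {d : ℕ} (A : Vec d →L[ℝ] Vec d) (V : Submodule ℝ (Vec d)) : ℝ :=
  Real.sqrt (ContinuousLinearMap.adjoint (A ∘L V.subtypeL) ∘L (A ∘L V.subtypeL)).det

end TorusAnosov

end

noncomputable section

namespace TorusAnosov

variable {d : ℕ}

/-! ### The covering projection -/

/-! In eigenbasis coordinates, `Df` is the diagonal matrix of the `β i` plus a perturbation of norm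
at most `ε`, with `ε` small against the gaps between the moduli `|β i|`. A graph transform
(`exists_invariant_section`, `exists_invariant_frame`) then gives, for every `i`, a continuous
nowhere zero field `e i` with `Df (e i) = μ i • e i ∘ f` and `|μ i - β i| ≤ ε`. Everything reduces
to the Birkhoff averages of the continuous functions `log |μ i|`.

These averages are controlled by periodic orbits. Since `f` is globally close to a linear map, it
lifts to a hyperbolic linear map plus a term that is Lipschitz-small on all of `ℝᵈ`. Hence any orbit
segment of any length `n` can be closed up, whatever the distance between its ends: a point of
period `n` follows the segment with an error decaying exponentially in the distance to the two ends
(`exists_periodic_shadowing`). If a continuous function has sum `n * l` along every orbit of period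
`n`, its averages therefore converge to `l` uniformly (`birkhoff_uniform_of_periodic`).

The hypothesis on the sums comes from constant periodic data: at a point of period `n` the
eigenvalues of `Dfⁿ` are the products of the `μ i`, whose moduli lie in disjoint intervals for
different `i`, so a conjugacy must match them index by index (`abs_cocycle_eq_of_periodic`). A fixed
point serves as the reference and provides `l`.

Vectors, determinants and Jacobians differ from the scalar cocycles only by norms and Gram
determinants of the frame, whose logarithms are bounded by compactness. The stable and unstable
bundles are identified by the signs of the exponents. -/

lemma proj_zero : proj (0 : Vec d) = 0 := by
  funext i; simp [proj]

lemma proj_add (v w : Vec d) : proj (v + w) = proj v + proj w := by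
  funext i; simp [proj]

lemma proj_sub (v w : Vec d) : proj (v - w) = proj v - proj w := by
  funext i; simp [proj]

lemma continuous_proj : Continuous (proj : Vec d → Torus d) := by
  refine continuous_pi fun i => ?_
  exact (AddCircle.continuous_mk' (1 : ℝ)).comp (EuclideanSpace.proj i : Vec d →L[ℝ] ℝ).continuous

lemma norm_proj_le (v : Vec d) : ‖proj v‖ ≤ ‖v‖ := by
  refine (pi_norm_le_iff_of_nonneg (norm_nonneg _)).2 fun i => ?_
  have h1 : ‖proj v i‖ ≤ ‖v i‖ := QuotientAddGroup.norm_mk_le_norm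
  exact h1.trans (PiLp.norm_apply_le v i)

/-- The representative in `(-1/2, 1/2]` of a point of the circle. -/
def circleLift (z : UnitAddCircle) : ℝ := AddCircle.equivIoc (1 : ℝ) (-(1 / 2)) z

lemma coe_circleLift (z : UnitAddCircle) : ((circleLift z : ℝ) : UnitAddCircle) = z :=
  AddCircle.coe_equivIoc

lemma abs_circleLift (z : UnitAddCircle) : |circleLift z| = ‖z‖ := by
  have h := (AddCircle.equivIoc (1 : ℝ) (-(1 / 2)) z).2
  have h1 : |circleLift z| ≤ |(1 : ℝ)| / 2 := by
    rw [abs_one, abs_le]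
    refine ⟨h.1.le, ?_⟩
    have := h.2
    simp only [circleLift]
    linarith
  rw [← (AddCircle.norm_coe_eq_abs_iff (1 : ℝ) one_ne_zero).2 h1, coe_circleLift]

/-- The lift jumps at the antipode of `0`, but two lifts of modulus at most `1/4` differ by at most
half a period, where the circle norm is the absolute value. This is the source of the condition `δ ≤
1 / 4`. -/
lemma abs_circleLift_sub {z w : UnitAddCircle} (hz : ‖z‖ ≤ 1 / 4) (hw : ‖w‖ ≤ 1 / 4) :
    |circleLift z - circleLift w| = ‖z - w‖ := by
  rw [← abs_circleLift] at hz hw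
  have h1 : |circleLift z - circleLift w| ≤ |(1 : ℝ)| / 2 := by
    rw [abs_one]
    linarith [abs_sub (circleLift z) (circleLift w)]
  rw [← (AddCircle.norm_coe_eq_abs_iff (1 : ℝ) one_ne_zero).2 h1, AddCircle.coe_sub,
    coe_circleLift, coe_circleLift]

/-- Coordinatewise representative in `(-1/2, 1/2]ᵈ`. -/
def torusLift (z : Torus d) : Vec d := WithLp.toLp 2 fun i => circleLift (z i)

lemma torusLift_apply (z : Torus d) (i : Fin d) : torusLift z i = circleLift (z i) := rfl

lemma proj_torusLift (z : Torus d) : proj (torusLift z) = z := by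
  funext i; exact coe_circleLift _

lemma torusLift_zero : torusLift (0 : Torus d) = 0 := by
  ext i
  have := abs_circleLift (0 : UnitAddCircle)
  simpa [torusLift_apply] using this

lemma norm_torusLift_le (z : Torus d) : ‖torusLift z‖ ≤ Real.sqrt d := by
  rw [EuclideanSpace.norm_eq]
  refine Real.sqrt_le_sqrt ?_
  have : ∀ i, ‖torusLift z i‖ ^ 2 ≤ 1 := fun i => by
    have h := AddCircle.norm_le_half_period (1 : ℝ) (x := z i) one_ne_zero
    rw [abs_one] at h
    rw [torusLift_apply, Real.norm_eq_abs, abs_circleLift]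
    nlinarith [norm_nonneg (z i)]
  calc _ ≤ ∑ _i : Fin d, (1 : ℝ) := Finset.sum_le_sum fun i _ => this i
    _ = d := by simp

lemma continuous_torusLift_comp {X : Type*} [TopologicalSpace X] {h : X → Torus d}
    (hc : Continuous h) (hs : ∀ x, ‖h x‖ ≤ 1 / 4) : Continuous fun x => torusLift (h x) := by
  refine (PiLp.continuous_toLp 2 _).comp (continuous_pi fun i => ?_)
  have hi : Continuous fun x => h x i := (continuous_apply i).comp hc
  refine continuous_iff_continuousAt.2 fun x => ?_
  rw [ContinuousAt, tendsto_iff_dist_tendsto_zero]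
  have h0 := tendsto_iff_dist_tendsto_zero.1 (hi.tendsto x)
  refine h0.congr fun y => ?_
  rw [dist_eq_norm, dist_eq_norm, Real.norm_eq_abs,
    abs_circleLift_sub ((norm_le_pi_norm _ i).trans (hs y)) ((norm_le_pi_norm _ i).trans (hs x))]

lemma eq_zero_of_proj_eq_zero {v : Vec d} (h : proj v = 0) (hv : ‖v‖ < 1) : v = 0 := by
  ext i
  have h1 : ((v i : ℝ) : UnitAddCircle) = 0 := congrFun h i
  obtain ⟨n, hn⟩ := (AddCircle.coe_eq_zero_iff (1 : ℝ)).1 h1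
  have h2 : |v i| < 1 := (PiLp.norm_apply_le v i).trans_lt hv
  rw [← hn] at h2 ⊢
  have : |(n : ℝ)| < 1 := by simpa using h2
  have h3 : |n| < 1 := by exact_mod_cast this
  have : n = 0 := Int.abs_lt_one_iff.1 h3
  simp [this]

/-- Two lifts differ by a lattice vector, and a lattice vector of norm less than `1` is zero. This
makes torus derivatives unique and identifies local charts with the global lift. -/
lemma eventuallyEq_of_proj_eq {g h : Vec d → Vec d} (hg : ContinuousAt g 0)
    (hh : ContinuousAt h 0) (h0 : g 0 = h 0) (he : ∀ᶠ v in 𝓝 0, proj (g v) = proj (h v)) :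
    g =ᶠ[𝓝 0] h := by
  have hlim : Tendsto (fun v => ‖g v - h v‖) (𝓝 0) (𝓝 0) := by
    have := (hg.sub hh).norm
    simpa [ContinuousAt, h0] using this
  filter_upwards [he, hlim.eventually (gt_mem_nhds one_pos)] with v h1 h2
  exact sub_eq_zero.1 (eq_zero_of_proj_eq_zero (by rw [proj_sub, h1, sub_self]) h2)

/-! ### Derivatives of torus maps -/

lemma HasTorusFDerivAt.unique {f : Torus d → Torus d} {A B : Vec d →L[ℝ] Vec d} {x : Torus d}
    (hA : HasTorusFDerivAt f A x) (hB : HasTorusFDerivAt f B x) : A = B := by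
  obtain ⟨g, g0, hg, eg⟩ := hA
  obtain ⟨h, h0, hh, eh⟩ := hB
  have : g =ᶠ[𝓝 0] h := by
    refine eventuallyEq_of_proj_eq hg.continuousAt hh.continuousAt (g0.trans h0.symm) ?_
    filter_upwards [eg, eh] with v h1 h2
    exact add_left_cancel (h1.symm.trans h2)
  exact (hg.congr_of_eventuallyEq this.symm).unique hh

lemma HasTorusFDerivAt.tderiv_eq {f : Torus d → Torus d} {A : Vec d →L[ℝ] Vec d} {x : Torus d}
    (hA : HasTorusFDerivAt f A x) : tderiv f x = A := by
  have h : ∃ A, HasTorusFDerivAt f A x := ⟨A, hA⟩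
  rw [tderiv, dif_pos h]
  exact h.choose_spec.unique hA

lemma hasTorusFDerivAt_tderiv {f : Torus d → Torus d} {x : Torus d}
    (h : ∃ A, HasTorusFDerivAt f A x) : HasTorusFDerivAt f (tderiv f x) x := by
  rw [tderiv, dif_pos h]
  exact h.choose_spec

lemma HasTorusFDerivAt.comp {f g : Torus d → Torus d} {A B : Vec d →L[ℝ] Vec d} {x : Torus d}
    (hB : HasTorusFDerivAt g B (f x)) (hA : HasTorusFDerivAt f A x) :
    HasTorusFDerivAt (g ∘ f) (B ∘L A) x := by
  obtain ⟨k, k0, hk, ek⟩ := hA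
  obtain ⟨h, h0, hh, eh⟩ := hB
  refine ⟨h ∘ k, by simp [k0, h0], ?_, ?_⟩
  · exact HasFDerivAt.comp 0 (by rwa [k0]) hk
  · have hlim : Tendsto k (𝓝 0) (𝓝 0) := by
      simpa [ContinuousAt, k0] using hk.continuousAt
    filter_upwards [ek, hlim.eventually eh] with v h1 h2
    simp only [Function.comp_apply, h1, h2]

lemma hasTorusFDerivAt_id (x : Torus d) :
    HasTorusFDerivAt (fun y => y) (ContinuousLinearMap.id ℝ (Vec d)) x :=
  ⟨fun v => v, rfl, hasFDerivAt_id _, Eventually.of_forall fun _ => rfl⟩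

/-! ### The chain rule for integer iterates -/

section Cocycle

variable {f : Torus d ≃ₜ Torus d}

lemma exists_hasTorusFDerivAt_zpow (hf : ∀ x, ∃ A, HasTorusFDerivAt f A x)
    (hf' : ∀ x, ∃ A, HasTorusFDerivAt f.symm A x) (n : ℤ) (x : Torus d) :
    ∃ A, HasTorusFDerivAt (⇑(f ^ n)) A x := by
  induction n using Int.induction_on generalizing x with
  | zero => exact ⟨_, hasTorusFDerivAt_id x⟩
  | succ n ih =>
    obtain ⟨A, hA⟩ := hf x
    obtain ⟨B, hB⟩ := ih (f x)
    refine ⟨B ∘L A, ?_⟩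
    rw [zpow_add, zpow_one]
    exact hB.comp hA
  | pred n ih =>
    obtain ⟨A, hA⟩ := hf' x
    obtain ⟨B, hB⟩ := ih (f.symm x)
    refine ⟨B ∘L A, ?_⟩
    rw [sub_eq_add_neg, zpow_add, zpow_neg_one]
    exact hB.comp hA

lemma Dpow_zero (x : Torus d) : Dpow f 0 x = ContinuousLinearMap.id ℝ (Vec d) :=
  (hasTorusFDerivAt_id x).tderiv_eq

lemma Dpow_one (x : Torus d) : Dpow f 1 x = tderiv f x := by rw [Dpow, zpow_one]

lemma Dpow_add (hf : ∀ x, ∃ A, HasTorusFDerivAt f A x)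
    (hf' : ∀ x, ∃ A, HasTorusFDerivAt f.symm A x) (m n : ℤ) (x : Torus d) :
    Dpow f (m + n) x = Dpow f m ((f ^ n) x) ∘L Dpow f n x := by
  have h := (hasTorusFDerivAt_tderiv (exists_hasTorusFDerivAt_zpow hf hf' m ((f ^ n) x))).comp
    (hasTorusFDerivAt_tderiv (exists_hasTorusFDerivAt_zpow hf hf' n x))
  have e : ⇑(f ^ m) ∘ ⇑(f ^ n) = ⇑(f ^ (m + n)) := by rw [zpow_add]; rfl
  rw [e] at h
  exact h.tderiv_eq

lemma Dpow_neg_apply_Dpow (hf : ∀ x, ∃ A, HasTorusFDerivAt f A x)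
    (hf' : ∀ x, ∃ A, HasTorusFDerivAt f.symm A x) (n : ℤ) (x : Torus d) (v : Vec d) :
    Dpow f (-n) ((f ^ n) x) (Dpow f n x v) = v := by
  have := Dpow_add hf hf' (-n) n x
  rw [neg_add_cancel, Dpow_zero] at this
  exact (DFunLike.congr_fun this v).symm

lemma zpow_apply_zpow_neg {X : Type*} [TopologicalSpace X] (f : X ≃ₜ X) (n : ℤ) (x : X) :
    (f ^ n) ((f ^ (-n)) x) = x := by
  rw [← Homeomorph.mul_apply, ← zpow_add, add_neg_cancel, zpow_zero, Homeomorph.one_apply]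

lemma Dpow_apply_Dpow_neg (hf : ∀ x, ∃ A, HasTorusFDerivAt f A x)
    (hf' : ∀ x, ∃ A, HasTorusFDerivAt f.symm A x) (n : ℤ) (x : Torus d) (v : Vec d) :
    Dpow f n ((f ^ (-n)) x) (Dpow f (-n) x v) = v := by
  have := Dpow_neg_apply_Dpow hf hf' (-n) x v
  rwa [neg_neg] at this

lemma InvariantField.zpow {V : Torus d → Submodule ℝ (Vec d)} (hV : InvariantField f V)
    (hf : ∀ x, ∃ A, HasTorusFDerivAt f A x)
    (hf' : ∀ x, ∃ A, HasTorusFDerivAt f.symm A x) (n : ℤ) (x : Torus d) {v : Vec d}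
    (hv : v ∈ V x) : Dpow f n x v ∈ V ((f ^ n) x) := by
  induction n using Int.induction_on with
  | zero => simpa [Dpow_zero] using hv
  | succ n ih =>
    rw [add_comm, Dpow_add hf hf', zpow_add, zpow_one, Homeomorph.mul_apply, ← hV, Dpow_one]
    exact Submodule.mem_map_of_mem ih
  | pred n ih =>
    -- Going backwards uses injectivity of `Df`: the vector at the preceding point has the same
    -- image as some element of `V` there, hence equals it.
    have e : (-(n : ℤ)) = 1 + (-(n : ℤ) - 1) := by ring
    rw [e, Dpow_add hf hf', zpow_add, zpow_one, Homeomorph.mul_apply, ← hV, Dpow_one] at ih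
    obtain ⟨w, hw, hwe⟩ := ih
    set y := (f ^ (-(n : ℤ) - 1)) x
    have h1 := Dpow_neg_apply_Dpow hf hf' 1 y w
    have h2 := Dpow_neg_apply_Dpow hf hf' 1 y (Dpow f (-(n : ℤ) - 1) x v)
    rw [Dpow_one] at h1 h2
    have hwe' : tderiv f y w = tderiv f y (Dpow f (-(n : ℤ) - 1) x v) := hwe
    rw [← h2, ← hwe', h1]
    exact hw

end Cocycle

/-! ### The global lift of a map close to a linear one -/

/-- The linear map of `ℝᵈ` given by an integer matrix. -/
abbrev linCLM (M : Matrix (Fin d) (Fin d) ℤ) : Vec d →L[ℝ] Vec d :=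
  Matrix.toEuclideanCLM (n := Fin d) (𝕜 := ℝ) (realMatrix M)

lemma linMap_add (M : Matrix (Fin d) (Fin d) ℤ) (x y : Torus d) :
    linMap M (x + y) = linMap M x + linMap M y := by
  funext i; simp [linMap, Finset.sum_add_distrib]

lemma linMap_proj (M : Matrix (Fin d) (Fin d) ℤ) (v : Vec d) :
    linMap M (proj v) = proj (linCLM M v) := by
  funext i
  have h : (linCLM M v) i = ∑ j, M i j • v j := by
    simp [linCLM, Matrix.mulVec, dotProduct, realMatrix]
  simp only [linMap, proj, h]
  exact (map_sum (QuotientAddGroup.mk' (AddSubgroup.zmultiples (1 : ℝ))) _ _).symm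

lemma continuous_linMap (M : Matrix (Fin d) (Fin d) ℤ) : Continuous (linMap M) := by
  unfold linMap
  fun_prop

/-- The difference `f - linMap M` stays in the ball where `torusLift` is continuous, so it comes
from a continuous map to `ℝᵈ`, and no covering theory is needed. Since the lift is defined on all of
`ℝᵈ`, the mean value inequality later gives a global Lipschitz bound. -/
lemma exists_global_lift {f : Torus d ≃ₜ Torus d} {M : Matrix (Fin d) (Fin d) ℤ} {δ : ℝ}
    (hδ : δ ≤ 1 / 4) (hf : ∀ x, ∃ A, HasTorusFDerivAt f A x) (hc : C1Close δ f M) (y : Torus d) :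
    ∃ g : Vec d → Vec d, g 0 = 0 ∧ (∀ v, f (y + proj v) = f y + proj (g v)) ∧
      ∀ v, HasFDerivAt g (tderiv f (y + proj v)) v := by
  set ψ : Torus d → Vec d := fun x => torusLift (f x - linMap M x) with hψ
  have hψc : Continuous ψ := by
    refine continuous_torusLift_comp (f.continuous.sub (continuous_linMap M)) fun x => ?_
    rw [← dist_eq_norm]
    exact (hc x).1.le.trans hδ
  have hfψ : ∀ x, f x = linMap M x + proj (ψ x) := fun x => by
    rw [hψ, proj_torusLift, add_sub_cancel]
  set g : Vec d → Vec d := fun v => linCLM M v + (ψ (y + proj v) - ψ y) with hg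
  have hgc : Continuous g := by
    have := continuous_proj (d := d)
    fun_prop
  have hfg : ∀ v, f (y + proj v) = f y + proj (g v) := fun v => by
    rw [hfψ (y + proj v), hfψ y, linMap_add, linMap_proj, hg, proj_add, proj_sub]
    abel
  refine ⟨g, by simp [hg, proj_zero], hfg, fun v => ?_⟩
  obtain ⟨h, h0, hh, eh⟩ := hasTorusFDerivAt_tderiv (hf (y + proj v))
  have key : (fun w => g (v + w) - g v) =ᶠ[𝓝 0] h := by
    refine eventuallyEq_of_proj_eq ?_ hh.continuousAt (by simp [h0]) ?_
    · exact Continuous.continuousAt (by fun_prop)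
    · filter_upwards [eh] with w hw
      have h1 := hfg (v + w)
      rw [proj_add, ← add_assoc, hw, hfg v, add_assoc] at h1
      have h2 := add_left_cancel h1
      rw [proj_sub, ← h2]
      abel
  have h1 : HasFDerivAt (fun w => g (v + w) - g v) (tderiv f (y + proj v)) 0 :=
    hh.congr_of_eventuallyEq key
  have h2 : HasFDerivAt (fun w => g (v + w)) (tderiv f (y + proj v)) 0 := by
    simpa using h1.add_const (g v)
  have h3 : HasFDerivAt (fun u => u - v) (ContinuousLinearMap.id ℝ (Vec d)) v :=
    (hasFDerivAt_id v).sub_const v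
  have h4 : HasFDerivAt ((fun w => g (v + w)) ∘ fun u => u - v)
      (tderiv f (y + proj v) ∘L ContinuousLinearMap.id ℝ (Vec d)) v :=
    HasFDerivAt.comp v (by rwa [sub_self]) h3
  have e : ((fun w => g (v + w)) ∘ fun u => u - v) = g := by
    funext u; simp
  rwa [e, ContinuousLinearMap.comp_id] at h4

/-! ### Invariant line fields by the graph transform -/

section GraphTransform

variable {X ι : Type*} [TopologicalSpace X] [CompactSpace X] [Fintype ι] [DecidableEq ι]

/-- The graph transform for sections `u` of the affine hyperplane `{u i₀ = 1}` under the cocycle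
`v ↦ β * v + P x v` over `f`. -/
def graphTransform (f : X ≃ₜ X) (β : ι → ℝ) (P : C(X, (ι → ℝ) →L[ℝ] (ι → ℝ))) (i₀ : ι)
    (u : C(X, ι → ℝ)) : C(X, ι → ℝ) where
  toFun x j :=
    if j = i₀ then 1 else
    if |β j| < |β i₀| then
      (β j * u (f.symm x) j + P (f.symm x) (u (f.symm x)) j
        - P (f.symm x) (u (f.symm x)) i₀ * u x j) / β i₀
    else ((β i₀ + P x (u x) i₀) * u (f x) j - P x (u x) j) / β j
  continuous_toFun := by
    have hP : ∀ k, Continuous fun x => P x (u x) k := fun k =>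
      (continuous_apply k).comp (P.continuous.clm_apply u.continuous)
    have hu : ∀ k, Continuous fun x => u x k := fun k => (continuous_apply k).comp u.continuous
    have hP' : ∀ k, Continuous fun x => P (f.symm x) (u (f.symm x)) k := fun k =>
      (hP k).comp f.symm.continuous
    have hu' : ∀ k, Continuous fun x => u (f.symm x) k := fun k => (hu k).comp f.symm.continuous
    have hu'' : ∀ k, Continuous fun x => u (f x) k := fun k => (hu k).comp f.continuous
    refine continuous_pi fun j => ?_
    split_ifs
    · exact continuous_const
    · exact (((continuous_const.mul (hu' j)).add (hP' j)).sub ((hP' i₀).mul (hu j))).div_const _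
    · exact (((continuous_const.add (hP i₀)).mul (hu'' j)).sub (hP j)).div_const _

lemma abs_mul_sub_mul_le {p p' u u' ε D : ℝ} (hp : |p| ≤ ε) (hu' : |u'| ≤ 1)
    (hpp : |p - p'| ≤ ε * D) (huu : |u - u'| ≤ D) (hε : 0 ≤ ε) :
    |p * u - p' * u'| ≤ 2 * ε * D := by
  have e : p * u - p' * u' = p * (u - u') + (p - p') * u' := by ring
  have hD : 0 ≤ D := (abs_nonneg _).trans huu
  rw [e]
  calc _ ≤ |p| * |u - u'| + |p - p'| * |u'| := by
        rw [← abs_mul, ← abs_mul]; exact abs_add_le _ _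
    _ ≤ ε * D + (ε * D) * 1 := by gcongr
    _ = _ := by ring

/-- The invariance equation in coordinate `j` is solved for the value at the image point if `|β j| <
|β i₀|`, and at the source point otherwise. Either way the divisor is the constant of larger
modulus. The perturbation costs `3 * ε` in the Lipschitz estimate, which `h6` makes at most half the
gap; `h2` keeps the box of size `ρ` invariant. -/
lemma exists_invariant_section (f : X ≃ₜ X) (β : ι → ℝ) (P : C(X, (ι → ℝ) →L[ℝ] (ι → ℝ))) (i₀ : ι)
    {g B ε ρ : ℝ} (hg : 0 < g) (hε : 0 ≤ ε) (hρ0 : 0 ≤ ρ) (hρ : ρ ≤ 1)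
    (hgap : ∀ j, j ≠ i₀ → g ≤ |(|β j| - |β i₀|)|) (hB : ∀ j, |β j| ≤ B) (hβ0 : ∀ j, β j ≠ 0)
    (h6 : 6 * ε ≤ g) (h2 : 2 * ε ≤ ρ * g) (hP : ∀ x, ‖P x‖ ≤ ε) :
    ∃ u : C(X, ι → ℝ), (∀ x, u x i₀ = 1 ∧ ∀ j, j ≠ i₀ → |u x j| ≤ ρ) ∧
      ∀ x j, β j * u x j + P x (u x) j = (β i₀ + P x (u x) i₀) * u (f x) j := by
  set T := graphTransform f β P i₀ with hT
  set s : Set C(X, ι → ℝ) := {u | ∀ x, u x i₀ = 1 ∧ ∀ j, j ≠ i₀ → |u x j| ≤ ρ} with hs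
  have hBpos : 0 < B := (abs_pos.2 (hβ0 i₀)).trans_le (hB i₀)
  have hsnorm : ∀ u ∈ s, ∀ x, ‖u x‖ ≤ 1 := fun u hu x => by
    refine (pi_norm_le_iff_of_nonneg zero_le_one).2 fun j => ?_
    by_cases hj : j = i₀
    · rw [hj, (hu x).1, norm_one]
    · exact ((hu x).2 j hj).trans hρ
  have hs1 : ∀ u ∈ s, ∀ x j, |u x j| ≤ 1 := fun u hu x j =>
    (norm_le_pi_norm (u x) j).trans (hsnorm u hu x)
  have hPu : ∀ u ∈ s, ∀ x j, |P x (u x) j| ≤ ε := fun u hu x j =>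
    (norm_le_pi_norm (P x (u x)) j).trans <| ((P x).le_opNorm _).trans <| by
      calc _ ≤ ε * 1 := mul_le_mul (hP x) (hsnorm u hu x) (norm_nonneg _) hε
        _ = ε := mul_one ε
  have hmaps : Set.MapsTo T s s := fun u hu x => by
    refine ⟨by simp [hT, graphTransform], fun j hj => ?_⟩
    simp only [hT, graphTransform, ContinuousMap.coe_mk, if_neg hj]
    split_ifs with hlt
    · have hg' := hgap j hj
      rw [abs_of_neg (by linarith)] at hg'
      rw [abs_div, div_le_iff₀ (abs_pos.2 (hβ0 i₀))]
      have a1 := (hu (f.symm x)).2 j hj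
      have a2 := hPu u hu (f.symm x) j
      have a3 := hPu u hu (f.symm x) i₀
      have a4 := hs1 u hu x j
      calc _ ≤ |β j| * |u (f.symm x) j| + |P (f.symm x) (u (f.symm x)) j|
            + |P (f.symm x) (u (f.symm x)) i₀| * |u x j| := by
            rw [← abs_mul, ← abs_mul]
            exact (abs_sub _ _).trans (add_le_add_left (abs_add_le _ _) _)
        _ ≤ |β j| * ρ + ε + ε * 1 := by gcongr
        _ ≤ ρ * |β i₀| := by nlinarith
    · have hg' := hgap j hj
      rw [abs_of_nonneg (by linarith)] at hg'
      rw [abs_div, div_le_iff₀ (abs_pos.2 (hβ0 j))]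
      have a1 := (hu (f x)).2 j hj
      have a2 := hPu u hu x j
      have a3 := hPu u hu x i₀
      have a4 := hs1 u hu (f x) j
      calc _ ≤ |β i₀| * |u (f x) j| + |P x (u x) i₀| * |u (f x) j| + |P x (u x) j| := by
            rw [← abs_mul, ← abs_mul, add_mul]
            exact (abs_sub _ _).trans (add_le_add_left (abs_add_le _ _) _)
        _ ≤ |β i₀| * ρ + ε * 1 + ε := by gcongr
        _ ≤ ρ * |β j| := by nlinarith
  set κ : ℝ := 1 - g / (2 * B) / 2 with hκ
  have hgB : 0 < g / (2 * B) := by positivity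
  -- With a single coordinate there is no gap to compare with `B`, but the transform is then
  -- constantly `1`.
  by_cases hne : ∃ j, j ≠ i₀
  swap
  · push Not at hne
    refine ⟨T 0, fun x => ⟨by simp [hT, graphTransform], fun j hj => absurd (hne j) hj⟩,
      fun x j => ?_⟩
    rw [hne j]
    simp [hT, graphTransform]
  have hg2 : g ≤ 2 * B := by
    obtain ⟨j, hj⟩ := hne
    have := (hgap j hj).trans (abs_sub _ _)
    rw [abs_abs, abs_abs] at this
    linarith [hB j, hB i₀]
  have hgB1 : g / (2 * B) ≤ 1 := (div_le_one (by positivity)).2 hg2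
  have hκ0 : 0 ≤ κ := by rw [hκ]; linarith
  have hκ1 : κ < 1 := by rw [hκ]; linarith
  have hratio : ∀ a b, |β a| + g ≤ |β b| → |β a| + 3 * ε ≤ κ * |β b| := fun a b hab => by
    have h1 : g / (2 * B) * |β b| ≤ g / 2 := by
      calc _ ≤ g / (2 * B) * B := by gcongr; exact hB b
        _ = g / 2 := by field_simp
    rw [hκ]
    nlinarith
  have hcontr : ContractingWith ⟨κ, hκ0⟩ (hmaps.restrict T s s) := by
    refine ⟨by exact_mod_cast hκ1, LipschitzWith.of_dist_le_mul fun u w => ?_⟩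
    obtain ⟨u, hu⟩ := u
    obtain ⟨w, hw⟩ := w
    change dist (T u) (T w) ≤ κ * dist u w
    set D := dist u w with hD
    have hD0 : 0 ≤ D := dist_nonneg
    have hd : ∀ x, ‖u x - w x‖ ≤ D := fun x => by
      rw [← dist_eq_norm]; exact ContinuousMap.dist_apply_le_dist x
    have hdj : ∀ x j, |u x j - w x j| ≤ D := fun x j => (norm_le_pi_norm (u x - w x) j).trans (hd x)
    have hPd : ∀ x j, |P x (u x) j - P x (w x) j| ≤ ε * D := fun x j => by
      have h1 : |P x (u x - w x) j| ≤ ε * D :=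
        (norm_le_pi_norm (P x (u x - w x)) j).trans <| ((P x).le_opNorm _).trans <|
          mul_le_mul (hP x) (hd x) (norm_nonneg _) hε
      rwa [map_sub] at h1
    refine (ContinuousMap.dist_le (by positivity)).2 fun x => ?_
    refine (dist_pi_le_iff (by positivity)).2 fun j => ?_
    rw [Real.dist_eq]
    by_cases hj : j = i₀
    · simp only [hT, graphTransform, ContinuousMap.coe_mk, if_pos hj, sub_self, abs_zero]
      positivity
    simp only [hT, graphTransform, ContinuousMap.coe_mk, if_neg hj]
    split_ifs with hlt
    · have hg' := hgap j hj
      rw [abs_of_neg (by linarith)] at hg'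
      rw [← sub_div, abs_div, div_le_iff₀ (abs_pos.2 (hβ0 i₀))]
      have b1 := hdj (f.symm x) j
      have b2 := hPd (f.symm x) j
      have b3 := abs_mul_sub_mul_le (hPu u hu (f.symm x) i₀) (hs1 w hw x j)
        (hPd (f.symm x) i₀) (hdj x j) hε
      have b4 := hratio j i₀ (by linarith)
      have e : ∀ a b c p q r y : ℝ, (a * b + c - p) - (a * q + r - y) =
        a * (b - q) + (c - r) - (p - y) := fun a b c p q r y => by ring
      rw [e]
      calc _ ≤ |β j| * |u (f.symm x) j - w (f.symm x) j|
            + |P (f.symm x) (u (f.symm x)) j - P (f.symm x) (w (f.symm x)) j|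
            + |P (f.symm x) (u (f.symm x)) i₀ * u x j
                - P (f.symm x) (w (f.symm x)) i₀ * w x j| := by
            rw [← abs_mul]
            exact (abs_sub _ _).trans (add_le_add_left (abs_add_le _ _) _)
        _ ≤ |β j| * D + ε * D + 2 * ε * D := by gcongr
        _ = (|β j| + 3 * ε) * D := by ring
        _ ≤ (κ * |β i₀|) * D := by gcongr
        _ = _ := by ring
    · have hg' := hgap j hj
      rw [abs_of_nonneg (by linarith)] at hg'
      rw [← sub_div, abs_div, div_le_iff₀ (abs_pos.2 (hβ0 j))]
      have b1 := hdj (f x) j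
      have b2 := hPd x j
      have b3 := abs_mul_sub_mul_le (hPu u hu x i₀) (hs1 w hw (f x) j)
        (hPd x i₀) (hdj (f x) j) hε
      have b4 := hratio i₀ j (by linarith)
      have e : ∀ a p b c p' b' c' : ℝ, ((a + p) * b - c) - ((a + p') * b' - c') =
        a * (b - b') + (p * b - p' * b') - (c - c') := fun a p b c p' b' c' => by ring
      rw [e]
      calc _ ≤ |β i₀| * |u (f x) j - w (f x) j|
            + |P x (u x) i₀ * u (f x) j - P x (w x) i₀ * w (f x) j|
            + |P x (u x) j - P x (w x) j| := by
            rw [← abs_mul]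
            exact (abs_sub _ _).trans (add_le_add_left (abs_add_le _ _) _)
        _ ≤ |β i₀| * D + 2 * ε * D + ε * D := by gcongr
        _ = (|β i₀| + 3 * ε) * D := by ring
        _ ≤ (κ * |β j|) * D := by gcongr
        _ = _ := by ring
  have hclosed : IsClosed s := by
    have : s = ⋂ x, ({u : C(X, ι → ℝ) | u x i₀ = 1} ∩
        ⋂ j, ⋂ (_ : j ≠ i₀), {u : C(X, ι → ℝ) | |u x j| ≤ ρ}) := by
      ext u; simp [hs]
    have hev : ∀ x j, Continuous fun u : C(X, ι → ℝ) => u x j := fun x j =>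
      (continuous_apply j).comp (continuous_eval_const x)
    rw [this]
    refine isClosed_iInter fun x => IsClosed.inter (isClosed_eq (hev x i₀) continuous_const) ?_
    exact isClosed_iInter fun j => isClosed_iInter fun _ =>
      isClosed_le (hev x j).abs continuous_const
  have hmem : (ContinuousMap.const X (Pi.single i₀ (1 : ℝ))) ∈ s := fun x =>
    ⟨by simp, fun j hj => by simp [hj, hρ0]⟩
  obtain ⟨u, hu, hfix, -⟩ := hcontr.exists_fixedPoint' hclosed.isComplete hmaps hmem
    (edist_ne_top _ _)
  refine ⟨u, hu, fun x j => ?_⟩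
  by_cases hj : j = i₀
  · rw [hj, (hu x).1, (hu (f x)).1]; ring
  have hfix' : T u = u := hfix
  by_cases hlt : |β j| < |β i₀|
  -- In the pushed-forward coordinates the fixed-point equation at `f x` is the invariance equation
  -- at `x`.
  · have h := congrFun (DFunLike.congr_fun hfix' (f x)) j
    simp only [hT, graphTransform, ContinuousMap.coe_mk, if_neg hj, if_pos hlt,
      Homeomorph.symm_apply_apply] at h
    rw [div_eq_iff (hβ0 i₀)] at h
    linarith
  · have h := congrFun (DFunLike.congr_fun hfix' x) j
    simp only [hT, graphTransform, ContinuousMap.coe_mk, if_neg hj, if_neg hlt] at h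
    rw [div_eq_iff (hβ0 j)] at h
    linarith

end GraphTransform

/-! ### Closing pseudo-orbits of perturbed hyperbolic maps -/

section Closing

variable {J ι : Type*} [Fintype J] [Fintype ι]

/-- The operator whose fixed points solve `v (σ j) = β * v j + ψ j (v j)`. -/
def closingOperator (σ : Equiv.Perm J) (β : ι → ℝ) (ψ : J → (ι → ℝ) → ι → ℝ)
    (v : J → ι → ℝ) : J → ι → ℝ := fun j i =>
  if |β i| < 1 then β i * v (σ.symm j) i + ψ (σ.symm j) (v (σ.symm j)) i
  else (β i)⁻¹ * (v (σ j) i - ψ j (v j) i)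

/-- A pseudo-orbit, closed up along a permutation, of a Lipschitz-small perturbation of a
hyperbolic diagonal map is shadowed by an orbit. The shadowing distance contracts where there is
no jump. -/
lemma exists_closing (σ : Equiv.Perm J) (β : ι → ℝ) (ψ : J → (ι → ℝ) → ι → ℝ) {ε κ E : ℝ}
    (hε : 0 ≤ ε) (hE : 0 ≤ E) (hκ0 : 0 ≤ κ) (hκ : κ < 1)
    (hs : ∀ i, |β i| < 1 → |β i| + ε ≤ κ) (hu : ∀ i, ¬ |β i| < 1 → 1 + ε ≤ κ * |β i|)
    (hψ : ∀ j v w, ‖ψ j v - ψ j w‖ ≤ ε * ‖v - w‖) (hψ0 : ∀ j, ‖ψ j 0‖ ≤ E) :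
    ∃ v : J → ι → ℝ, (∀ j i, v (σ j) i = β i * v j i + ψ j (v j) i) ∧
      (∀ j, ‖v j‖ ≤ E / (1 - κ)) ∧
      ∀ j R, ψ j 0 = 0 → ψ (σ.symm j) 0 = 0 → ‖v j‖ ≤ R → ‖v (σ j)‖ ≤ R → ‖v (σ.symm j)‖ ≤ R →
        ‖v j‖ ≤ κ * R := by
  set T := closingOperator σ β ψ with hT
  -- The operator at `j` sees only `j` and its two neighbours. The estimate is kept local because it
  -- is used twice: for the global contraction, and with `w = 0` for the decay away from jumps.
  have hpt : ∀ v w : J → ι → ℝ, ∀ j R, ‖v j - w j‖ ≤ R → ‖v (σ j) - w (σ j)‖ ≤ R →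
      ‖v (σ.symm j) - w (σ.symm j)‖ ≤ R → ‖T v j - T w j‖ ≤ κ * R := by
    intro v w j R h1 h2 h3
    have hR : 0 ≤ R := (norm_nonneg _).trans h1
    refine (pi_norm_le_iff_of_nonneg (by positivity)).2 fun i => ?_
    have hc : ∀ k, ‖v k - w k‖ ≤ R → |v k i - w k i| ≤ R := fun k hk =>
      (norm_le_pi_norm (v k - w k) i).trans hk
    have hcψ : ∀ k, ‖v k - w k‖ ≤ R → |ψ k (v k) i - ψ k (w k) i| ≤ ε * R := fun k hk =>
      (norm_le_pi_norm (ψ k (v k) - ψ k (w k)) i).trans ((hψ k _ _).trans (by gcongr))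
    rw [Pi.sub_apply, Real.norm_eq_abs]
    simp only [hT, closingOperator]
    split_ifs with hlt
    · have e : ∀ a b c q r : ℝ, (a * b + c) - (a * q + r) = a * (b - q) + (c - r) :=
        fun a b c q r => by ring
      rw [e]
      refine (abs_add_le _ _).trans ?_
      rw [abs_mul]
      have c1 := hc _ h3
      have c2 := hcψ _ h3
      calc _ ≤ |β i| * R + ε * R := by gcongr
        _ = (|β i| + ε) * R := by ring
        _ ≤ κ * R := by gcongr; exact hs i hlt
    · have hβ : 0 < |β i| := by linarith [not_lt.1 hlt]
      have e : ∀ a b c q r : ℝ, a * (b - c) - a * (q - r) = a * ((b - q) - (c - r)) :=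
        fun a b c q r => by ring
      rw [e, abs_mul, abs_inv, inv_mul_le_iff₀ hβ]
      have c1 := hc _ h2
      have c2 := hcψ _ h1
      calc _ ≤ R + ε * R := (abs_sub _ _).trans (add_le_add c1 c2)
        _ = (1 + ε) * R := by ring
        _ ≤ (κ * |β i|) * R := by gcongr; exact hu i hlt
        _ = _ := by ring
  have hcontr : ContractingWith ⟨κ, hκ0⟩ T := by
    refine ⟨by exact_mod_cast hκ, LipschitzWith.of_dist_le_mul fun v w => ?_⟩
    change dist (T v) (T w) ≤ κ * dist v w
    have hk : ∀ k, ‖v k - w k‖ ≤ dist v w := fun k => by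
      rw [← dist_eq_norm]; exact dist_le_pi_dist v w k
    refine (dist_pi_le_iff (by positivity)).2 fun j => ?_
    rw [dist_eq_norm]
    exact hpt v w j _ (hk _) (hk _) (hk _)
  obtain ⟨v, hfix, -⟩ := hcontr.exists_fixedPoint (0 : J → ι → ℝ) (edist_ne_top _ _)
  have hfix' : T v = v := hfix
  have hT0 : ∀ j, ‖T 0 j‖ ≤ E := fun j => by
    refine (pi_norm_le_iff_of_nonneg hE).2 fun i => ?_
    have hb : ∀ k, |ψ k 0 i| ≤ E := fun k => (norm_le_pi_norm (ψ k 0) i).trans (hψ0 k)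
    simp only [hT, closingOperator, Pi.zero_apply, mul_zero, zero_add, zero_sub]
    split_ifs with hlt
    · exact hb _
    · have h1 := not_lt.1 hlt
      rw [Real.norm_eq_abs, abs_mul, abs_inv, abs_neg]
      calc _ ≤ 1 * E := by gcongr; exacts [inv_le_one_of_one_le₀ h1, hb _]
        _ = E := one_mul E
  have hbound : ‖v‖ ≤ E / (1 - κ) := by
    rw [le_div_iff₀ (by linarith)]
    have h1 : ‖T v - T 0‖ ≤ κ * ‖v‖ := by
      have := hcontr.2.dist_le_mul v 0
      rwa [dist_eq_norm, dist_zero_right] at this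
    have h2 : ‖T 0‖ ≤ E := (pi_norm_le_iff_of_nonneg hE).2 hT0
    have h3 : ‖v‖ ≤ ‖T v - T 0‖ + ‖T 0‖ := by
      rw [hfix']
      simpa using norm_add_le (v - T 0) (T 0)
    linarith
  refine ⟨v, fun j i => ?_, fun j => (norm_le_pi_norm v j).trans hbound, ?_⟩
  · by_cases hlt : |β i| < 1
    · have h := congrFun (congrFun hfix' (σ j)) i
      simp only [hT, closingOperator, if_pos hlt, Equiv.symm_apply_apply] at h
      exact h.symm
    · have h := congrFun (congrFun hfix' j) i
      have hβ : β i ≠ 0 := fun h0 => hlt (by rw [h0, abs_zero]; exact one_pos)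
      simp only [hT, closingOperator, if_neg hlt] at h
      rw [inv_mul_eq_iff_eq_mul₀ hβ] at h
      linarith
  · intro j R h0 h0' h1 h2 h3
    have hT0j : T 0 j = 0 := by
      funext i
      simp [hT, closingOperator, h0, h0']
    have := hpt v 0 j R (by simpa using h1) (by simpa using h2) (by simpa using h3)
    rwa [hfix', hT0j, sub_zero] at this

end Closing

lemma zpow_succ_apply {X : Type*} [TopologicalSpace X] (f : X ≃ₜ X) (k : ℕ) (x : X) :
    (f ^ ((k + 1 : ℕ) : ℤ)) x = f ((f ^ (k : ℤ)) x) := by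
  rw [Nat.cast_succ, add_comm, zpow_add, zpow_one, Homeomorph.mul_apply]

lemma zpow_zero_apply {X : Type*} [TopologicalSpace X] (f : X ≃ₜ X) (x : X) :
    (f ^ ((0 : ℕ) : ℤ)) x = x := by
  rw [Nat.cast_zero, zpow_zero, Homeomorph.one_apply]

/-! ### Closing lemma on the torus -/

section TorusClosing

variable {M : Matrix (Fin d) (Fin d) ℤ} {β : Fin d → ℝ} {b : Module.Basis (Fin d) ℝ (Vec d)}

lemma repr_apply_of_eigenbasis {ι V : Type*} [Fintype ι] [AddCommGroup V] [Module ℝ V]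
    (b : Module.Basis ι ℝ V) (T : V →ₗ[ℝ] V) {c : ι → ℝ} (hb : ∀ i, T (b i) = c i • b i)
    (v : V) (i : ι) : b.repr (T v) i = c i * b.repr v i := by
  classical
  have h : T v = ∑ j, (b.repr v j * c j) • b j := by
    conv_lhs => rw [← b.sum_repr v]
    rw [map_sum]
    simp only [map_smul, hb, smul_smul]
  rw [h, b.repr_sum_self, mul_comm]

lemma equivFunL_linCLM (hb : ∀ i, linCLM M (b i) = β i • b i) (v : Vec d) (i : Fin d) :
    b.equivFunL (linCLM M v) i = β i * b.equivFunL v i :=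
  repr_apply_of_eigenbasis b (linCLM M : Vec d →ₗ[ℝ] Vec d) hb v i

/-- The segment is made cyclic over `ZMod n`, with one jump, from the last point to the first. The
jump need not be small: its lift has norm at most `√d`, and the hyperbolic estimates hold on all of
`ℝᵈ`. Hence `R` depends neither on `x` nor on `n`. -/
lemma exists_periodic_shadowing {f : Torus d ≃ₜ Torus d} {δ ε κ : ℝ} (hδ : δ ≤ 1 / 4)
    (hf : ∀ x, ∃ A, HasTorusFDerivAt f A x) (hc : C1Close δ f M)
    (hb : ∀ i, linCLM M (b i) = β i • b i)
    (hδε : ‖(b.equivFunL : Vec d →L[ℝ] (Fin d → ℝ))‖ * δ *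
      ‖(b.equivFunL.symm : (Fin d → ℝ) →L[ℝ] Vec d)‖ ≤ ε)
    (hε : 0 ≤ ε) (hκ0 : 0 ≤ κ) (hκ : κ < 1)
    (hs : ∀ i, |β i| < 1 → |β i| + ε ≤ κ) (hu : ∀ i, ¬ |β i| < 1 → 1 + ε ≤ κ * |β i|) :
    ∃ R : ℝ, 0 ≤ R ∧ ∀ (x : Torus d) (n : ℕ), 0 < n → ∃ p, (f ^ (n : ℤ)) p = p ∧
      ∀ m k : ℕ, m ≤ k → k + m + 1 ≤ n →
        dist ((f ^ (k : ℤ)) p) ((f ^ (k : ℤ)) x) ≤ R * κ ^ m := by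
  set Φ := b.equivFunL
  choose g g0 hfg hg' using exists_global_lift hδ hf hc
  have hlip : ∀ y v w, ‖(g y v - linCLM M v) - (g y w - linCLM M w)‖ ≤ δ * ‖v - w‖ := by
    intro y v w
    have hd : ∀ u ∈ Set.univ, HasFDerivWithinAt (fun v => g y v - linCLM M v)
        (tderiv f (y + proj u) - linCLM M) Set.univ u := fun u _ =>
      ((hg' y u).sub (linCLM M).hasFDerivAt).hasFDerivWithinAt
    exact convex_univ.norm_image_sub_le_of_norm_hasFDerivWithin_le hd
      (fun u _ => (hc (y + proj u)).2.le) (Set.mem_univ w) (Set.mem_univ v)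
  set E : ℝ := ‖(Φ : Vec d →L[ℝ] (Fin d → ℝ))‖ * Real.sqrt d with hE
  set R₀ : ℝ := E / (1 - κ) with hR₀
  have hE0 : 0 ≤ E := by positivity
  have hR₀0 : 0 ≤ R₀ := div_nonneg hE0 (by linarith)
  refine ⟨‖(Φ.symm : (Fin d → ℝ) →L[ℝ] Vec d)‖ * R₀, by positivity, fun x n hn => ?_⟩
  have : NeZero n := ⟨hn.ne'⟩
  set y : ZMod n → Torus d := fun j => (f ^ (j.val : ℤ)) x with hy
  set e : ZMod n → Vec d := fun j => torusLift (f (y j) - y (j + 1)) with he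
  have hye : ∀ j, f (y j) = y (j + 1) + proj (e j) := fun j => by
    rw [he, proj_torusLift, add_sub_cancel]
  -- Only the last index wraps around.
  have he0 : ∀ j : ZMod n, j.val + 1 < n → e j = 0 := fun j hj => by
    have : y (j + 1) = f (y j) := by
      have e : j + 1 = ((j.val + 1 : ℕ) : ZMod n) := by simp
      simp only [hy]
      rw [e, ZMod.val_natCast_of_lt hj, zpow_succ_apply]
    rw [he]
    simp only
    rw [this, sub_self, torusLift_zero]
  set ψ : ZMod n → (Fin d → ℝ) → Fin d → ℝ := fun j c =>
    Φ (g (y j) (Φ.symm c) - linCLM M (Φ.symm c) + e j) with hψ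
  have hψlip : ∀ j v w, ‖ψ j v - ψ j w‖ ≤ ε * ‖v - w‖ := by
    intro j v w
    rw [hψ]
    simp only
    rw [← map_sub, add_sub_add_right_eq_sub]
    calc _ ≤ ‖(Φ : Vec d →L[ℝ] (Fin d → ℝ))‖ * (δ * ‖Φ.symm v - Φ.symm w‖) :=
          ((Φ : Vec d →L[ℝ] (Fin d → ℝ)).le_opNorm _).trans
            (mul_le_mul_of_nonneg_left (hlip _ _ _) (norm_nonneg _))
      _ = ‖(Φ : Vec d →L[ℝ] (Fin d → ℝ))‖ * (δ * ‖Φ.symm (v - w)‖) := by rw [map_sub]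
      _ ≤ ‖(Φ : Vec d →L[ℝ] (Fin d → ℝ))‖ *
          (δ * (‖(Φ.symm : (Fin d → ℝ) →L[ℝ] Vec d)‖ * ‖v - w‖)) := by
          have h0 : 0 ≤ δ := (dist_nonneg).trans (hc x).1.le
          exact mul_le_mul_of_nonneg_left (mul_le_mul_of_nonneg_left
            ((Φ.symm : (Fin d → ℝ) →L[ℝ] Vec d).le_opNorm _) h0) (norm_nonneg _)
      _ = (‖(Φ : Vec d →L[ℝ] (Fin d → ℝ))‖ * δ *
          ‖(Φ.symm : (Fin d → ℝ) →L[ℝ] Vec d)‖) * ‖v - w‖ := by ring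
      _ ≤ _ := mul_le_mul_of_nonneg_right hδε (norm_nonneg _)
  have hψ00 : ∀ j, ψ j 0 = Φ (e j) := fun j => by simp [hψ, g0]
  have hψ0 : ∀ j, ‖ψ j 0‖ ≤ E := fun j => by
    rw [hψ00]
    exact ((Φ : Vec d →L[ℝ] (Fin d → ℝ)).le_opNorm _).trans
      (mul_le_mul_of_nonneg_left (norm_torusLift_le _) (norm_nonneg _))
  obtain ⟨v, hv, hvb, hvd⟩ := exists_closing (Equiv.addRight (1 : ZMod n)) β ψ hε hE0 hκ0 hκ hs hu
    hψlip hψ0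
  simp only [Equiv.coe_addRight, Equiv.addRight_symm, ← sub_eq_add_neg] at hv hvd
  have hw : ∀ j, Φ.symm (v (j + 1)) = g (y j) (Φ.symm (v j)) + e j := fun j => by
    rw [ContinuousLinearEquiv.symm_apply_eq]
    funext i
    rw [hv, hψ]
    simp only [map_add, map_sub, Pi.add_apply, Pi.sub_apply]
    rw [equivFunL_linCLM hb, ContinuousLinearEquiv.apply_symm_apply]
    ring
  have hstep : ∀ j, f (y j + proj (Φ.symm (v j))) = y (j + 1) + proj (Φ.symm (v (j + 1))) :=
    fun j => by
      rw [hfg, hye, hw, proj_add]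
      abel
  set p := y 0 + proj (Φ.symm (v 0)) with hp
  have horb : ∀ k : ℕ, (f ^ (k : ℤ)) p = y k + proj (Φ.symm (v k)) := fun k => by
    induction k with
    | zero => rw [zpow_zero_apply, Nat.cast_zero]
    | succ k ih => rw [zpow_succ_apply, ih, hstep, Nat.cast_succ]
  -- The two inequalities say that `k` is at least `m` steps from both ends `0` and `n - 1`. The
  -- neighbours of an index at depth `m + 1` have depth `m`, and no jump interferes, so each step
  -- inward gains a factor `κ`.
  have hdecay : ∀ m k : ℕ, m ≤ k → k + m + 1 ≤ n → ‖v k‖ ≤ R₀ * κ ^ m := fun m => by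
    induction m with
    | zero => intro k _ _; rw [pow_zero, mul_one]; exact hvb k
    | succ m ih =>
      intro k hk hkn
      obtain ⟨k, rfl⟩ : ∃ k', k = k' + 1 := ⟨k - 1, by omega⟩
      have hval : ∀ l : ℕ, l < n → (l : ZMod n).val = l := fun l hl => ZMod.val_natCast_of_lt hl
      have e1 : ((k + 1 : ℕ) : ZMod n) + 1 = ((k + 2 : ℕ) : ZMod n) := by push_cast; ring
      have e2 : ((k + 1 : ℕ) : ZMod n) - 1 = (k : ZMod n) := by push_cast; ring
      have h := hvd ((k + 1 : ℕ) : ZMod n) (R₀ * κ ^ m)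
        (by rw [hψ00, he0 _ (by rw [hval] <;> omega), map_zero])
        (by rw [e2, hψ00, he0 _ (by rw [hval] <;> omega), map_zero])
        (ih _ (by omega) (by omega))
        (by rw [e1]; exact ih _ (by omega) (by omega))
        (by rw [e2]; exact ih _ (by omega) (by omega))
      calc _ ≤ κ * (R₀ * κ ^ m) := h
        _ = _ := by ring
  refine ⟨p, by rw [horb, ZMod.natCast_self], fun m k hm hk => ?_⟩
  have hyk : y k = (f ^ (k : ℤ)) x := by
    simp only [hy]
    rw [ZMod.val_natCast_of_lt (by omega)]
  rw [horb, hyk, dist_eq_norm, add_sub_cancel_left]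
  calc _ ≤ ‖Φ.symm (v k)‖ := norm_proj_le _
    _ ≤ ‖(Φ.symm : (Fin d → ℝ) →L[ℝ] Vec d)‖ * ‖v k‖ :=
        (Φ.symm : (Fin d → ℝ) →L[ℝ] Vec d).le_opNorm _
    _ ≤ ‖(Φ.symm : (Fin d → ℝ) →L[ℝ] Vec d)‖ * (R₀ * κ ^ m) := by
        exact mul_le_mul_of_nonneg_left (hdecay m k hm hk) (norm_nonneg _)
    _ = _ := by ring

end TorusClosing

/-! ### Birkhoff sums determined by periodic orbits -/

/-- Compare a segment with the periodic orbit of the same length that shadows it. Uniform continuity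
handles all but `m` terms at each end, and those contribute a bound independent of `n`. -/
lemma birkhoff_uniform_of_periodic {X : Type*} [PseudoMetricSpace X] [CompactSpace X] (f : X ≃ₜ X)
    {R κ : ℝ} (hκ0 : 0 ≤ κ) (hκ : κ < 1)
    (hclose : ∀ (x : X) (n : ℕ), 0 < n → ∃ p, (f ^ (n : ℤ)) p = p ∧
      ∀ m k : ℕ, m ≤ k → k + m + 1 ≤ n →
        dist ((f ^ (k : ℤ)) p) ((f ^ (k : ℤ)) x) ≤ R * κ ^ m)
    {a : X → ℝ} (ha : Continuous a) {l : ℝ}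
    (hper : ∀ (p : X) (n : ℕ), 0 < n → (f ^ (n : ℤ)) p = p →
      ∑ k ∈ Finset.range n, a ((f ^ (k : ℤ)) p) = n * l) {ε : ℝ} (hε : 0 < ε) :
    ∃ N : ℕ, ∀ n : ℕ, N ≤ n → ∀ x,
      |∑ k ∈ Finset.range n, a ((f ^ (k : ℤ)) x) - n * l| ≤ ε * n := by
  obtain ⟨A, hA⟩ := isCompact_univ.exists_bound_of_continuousOn ha.continuousOn
  have hA' : ∀ x, |a x| ≤ |A| := fun x => (hA x (Set.mem_univ x)).trans (le_abs_self A)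
  obtain ⟨η, hη, hηa⟩ := Metric.uniformContinuous_iff.1
    (CompactSpace.uniformContinuous_of_continuous ha) (ε / 2) (by positivity)
  obtain ⟨m, hm⟩ : ∃ m : ℕ, R * κ ^ m < η := by
    have : Tendsto (fun m : ℕ => R * κ ^ m) atTop (𝓝 (R * 0)) :=
      (tendsto_pow_atTop_nhds_zero_of_lt_one hκ0 hκ).const_mul R
    rw [mul_zero] at this
    exact (this.eventually (gt_mem_nhds hη)).exists
  -- The end terms amount to at most `4 * |A| * m`, which must be at most `ε * n / 2`.
  obtain ⟨N, hN⟩ := exists_nat_gt (8 * |A| * m / ε)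
  refine ⟨N + 1, fun n hn x => ?_⟩
  obtain ⟨p, hp, hpx⟩ := hclose x n (by omega)
  rw [← hper p n (by omega) hp, ← Finset.sum_sub_distrib]
  have hterm : ∀ k ∈ Finset.range n, |a ((f ^ (k : ℤ)) x) - a ((f ^ (k : ℤ)) p)| ≤
      ε / 2 + ((if k < m then 2 * |A| else 0) + if n - m ≤ k then 2 * |A| else 0) := by
    intro k hk
    have hkn := Finset.mem_range.1 hk
    have hbig : |a ((f ^ (k : ℤ)) x) - a ((f ^ (k : ℤ)) p)| ≤ 2 * |A| := by
      linarith [abs_sub (a ((f ^ (k : ℤ)) x)) (a ((f ^ (k : ℤ)) p)), hA' ((f ^ (k : ℤ)) x),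
        hA' ((f ^ (k : ℤ)) p)]
    have := abs_nonneg A
    by_cases h1 : k < m
    · rw [if_pos h1]
      split_ifs <;> linarith
    by_cases h2 : n - m ≤ k
    · rw [if_pos h2, if_neg h1]
      linarith
    · rw [if_neg h1, if_neg h2]
      have h3 : dist ((f ^ (k : ℤ)) x) ((f ^ (k : ℤ)) p) < η := by
        rw [dist_comm]
        exact (hpx m k (by omega) (by omega)).trans_lt hm
      have := hηa h3
      rw [Real.dist_eq] at this
      linarith
  have hn' : (8 * |A| * m / ε) < n := hN.trans_le (by exact_mod_cast (by omega : N ≤ n))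
  rw [div_lt_iff₀ hε] at hn'
  have hc1 : ∑ k ∈ Finset.range n, (if k < m then 2 * |A| else 0) ≤ m * (2 * |A|) := by
    rw [← Finset.sum_filter, Finset.sum_const, nsmul_eq_mul]
    gcongr
    calc _ ≤ (Finset.range m).card := Finset.card_le_card fun k hk => by
          simp only [Finset.mem_filter, Finset.mem_range] at hk ⊢; omega
      _ = m := Finset.card_range m
  have hc2 : ∑ k ∈ Finset.range n, (if n - m ≤ k then 2 * |A| else 0) ≤ m * (2 * |A|) := by
    rw [← Finset.sum_filter, Finset.sum_const, nsmul_eq_mul]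
    gcongr
    calc _ ≤ (Finset.Ico (n - m) n).card := Finset.card_le_card fun k hk => by
          simp only [Finset.mem_filter, Finset.mem_range, Finset.mem_Ico] at hk ⊢; omega
      _ ≤ m := by rw [Nat.card_Ico]; omega
  calc _ ≤ ∑ k ∈ Finset.range n, |a ((f ^ (k : ℤ)) x) - a ((f ^ (k : ℤ)) p)| :=
        Finset.abs_sum_le_sum_abs _ _
    _ ≤ ∑ k ∈ Finset.range n,
        (ε / 2 + ((if k < m then 2 * |A| else 0) + if n - m ≤ k then 2 * |A| else 0)) :=
        Finset.sum_le_sum hterm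
    _ ≤ n * (ε / 2) + (m * (2 * |A|) + m * (2 * |A|)) := by
        rw [Finset.sum_add_distrib, Finset.sum_add_distrib, Finset.sum_const, Finset.card_range,
          nsmul_eq_mul]
        gcongr
    _ ≤ ε * n := by linarith

/-! ### Uniform exponential rates -/

section UniformRate

variable {X Y : Type*}

/-- `s n x / n → l` as `|n| → ∞`, uniformly in `x`. -/
def UniformRate (s : ℤ → X → ℝ) (l : ℝ) : Prop :=
  ∀ ε : ℝ, 0 < ε → ∀ᶠ n : ℤ in cofinite, ∀ x, |(1 / (n : ℝ)) * s n x - l| < ε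

lemma eventually_cofinite_le_abs (K : ℕ) : ∀ᶠ n : ℤ in cofinite, (K : ℤ) ≤ |n| := by
  refine (Set.finite_Ioo (-(K : ℤ)) K).subset fun n hn => ?_
  exact abs_lt.1 (not_le.1 hn)

lemma exists_nat_of_eventually_cofinite {p : ℤ → Prop} (h : ∀ᶠ n in cofinite, p n) :
    ∃ N : ℕ, ∀ n : ℤ, (N : ℤ) ≤ |n| → p n := by
  obtain ⟨B, hB⟩ := ((eventually_cofinite.1 h).image abs).bddAbove
  refine ⟨(B + 1).toNat, fun n hn => ?_⟩
  by_contra hp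
  have := hB (Set.mem_image_of_mem abs hp)
  omega

lemma UniformRate.comp {s : ℤ → X → ℝ} {l : ℝ} (hs : UniformRate s l) (h : Y → X) :
    UniformRate (fun n y => s n (h y)) l := fun ε hε =>
  (hs ε hε).mono fun _ hn y => hn (h y)

/-- Division by `n` removes bounded errors; this absorbs all norms, angles and normalisations of the
frame. -/
lemma UniformRate.of_bounded_sub {s t : ℤ → X → ℝ} {l : ℝ} (hs : UniformRate s l) {C : ℝ}
    (hC : ∀ n x, |t n x - s n x| ≤ C) : UniformRate t l := by
  intro ε hε
  obtain ⟨K, hK⟩ := exists_nat_gt (C / (ε / 2))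
  filter_upwards [hs (ε / 2) (by positivity), eventually_cofinite_le_abs (K + 1)] with n h1 h2 x
  have hn : ((K : ℝ) + 1) ≤ |(n : ℝ)| := by exact_mod_cast h2
  have hn0 : 0 < |(n : ℝ)| := lt_of_lt_of_le (by positivity) hn
  have h3 : |(1 / (n : ℝ)) * (t n x - s n x)| < ε / 2 := by
    rw [abs_mul, abs_div, abs_one, one_div, inv_mul_lt_iff₀ hn0]
    rw [div_lt_iff₀ (by positivity)] at hK
    nlinarith [hC n x]
  have e : (1 / (n : ℝ)) * t n x - l =
      (1 / (n : ℝ)) * (t n x - s n x) + ((1 / (n : ℝ)) * s n x - l) := by ring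
  rw [e]
  linarith [abs_add_le ((1 / (n : ℝ)) * (t n x - s n x)) ((1 / (n : ℝ)) * s n x - l), h1 x]

lemma UniformRate.zero : UniformRate (fun _ (_ : X) => 0) 0 := fun ε hε =>
  Eventually.of_forall fun n x => by simpa using hε

lemma UniformRate.add {s t : ℤ → X → ℝ} {l m : ℝ} (hs : UniformRate s l) (ht : UniformRate t m) :
    UniformRate (fun n x => s n x + t n x) (l + m) := by
  intro ε hε
  filter_upwards [hs (ε / 2) (by positivity), ht (ε / 2) (by positivity)] with n h1 h2 x
  have e : (1 / (n : ℝ)) * (s n x + t n x) - (l + m) =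
      ((1 / (n : ℝ)) * s n x - l) + ((1 / (n : ℝ)) * t n x - m) := by ring
  rw [e]
  linarith [abs_add_le ((1 / (n : ℝ)) * s n x - l) ((1 / (n : ℝ)) * t n x - m), h1 x, h2 x]

lemma UniformRate.sum {ι : Type*} {s : ι → ℤ → X → ℝ} {l : ι → ℝ}
    (hs : ∀ i, UniformRate (s i) (l i)) (I : Finset ι) :
    UniformRate (fun n x => ∑ i ∈ I, s i n x) (∑ i ∈ I, l i) := by
  classical
  induction I using Finset.induction_on with
  | empty => simpa using UniformRate.zero
  | insert i I hi ih =>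
    simp only [Finset.sum_insert hi]
    exact (hs i).add ih

lemma UniformRate.tendsto {s : ℤ → X → ℝ} {l : ℝ} (hs : UniformRate s l) (x : X) :
    Tendsto (fun n : ℤ => (1 / (n : ℝ)) * s n x) cofinite (𝓝 l) := by
  rw [Metric.tendsto_nhds]
  intro ε hε
  exact (hs ε hε).mono fun n hn => by rw [Real.dist_eq]; exact hn x

lemma atTop_le_cofinite_int : (atTop : Filter ℤ) ≤ cofinite := by
  rw [Int.cofinite_eq]; exact le_sup_right

lemma atBot_le_cofinite_int : (atBot : Filter ℤ) ≤ cofinite := by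
  rw [Int.cofinite_eq]; exact le_sup_left

lemma exists_abs_log_le [TopologicalSpace X] [CompactSpace X] {h : X → ℝ} (hc : Continuous h)
    (h0 : ∀ x, h x ≠ 0) : ∃ C, ∀ x, |Real.log (h x)| ≤ C := by
  obtain ⟨C, hC⟩ := isCompact_univ.exists_bound_of_continuousOn (hc.log h0).continuousOn
  exact ⟨C, fun x => hC x (Set.mem_univ x)⟩

end UniformRate

/-! ### Scalar cocycles -/

section ScalarCocycle

variable {X : Type*} [TopologicalSpace X]

/-- The multiplicative cocycle over `f` generated by `μ`. -/
def cocycle (f : X ≃ₜ X) (μ : X → ℝ) : ℤ → X → ℝ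
  | Int.ofNat n, x => ∏ k ∈ Finset.range n, μ ((f ^ (k : ℤ)) x)
  | Int.negSucc n, x =>
    (∏ k ∈ Finset.range (n + 1), μ ((f ^ (k : ℤ)) ((f ^ (-((n + 1 : ℕ) : ℤ))) x)))⁻¹

lemma cocycle_natCast (f : X ≃ₜ X) (μ : X → ℝ) (n : ℕ) (x : X) :
    cocycle f μ n x = ∏ k ∈ Finset.range n, μ ((f ^ (k : ℤ)) x) := rfl

lemma cocycle_negSucc (f : X ≃ₜ X) (μ : X → ℝ) (n : ℕ) (x : X) :
    cocycle f μ (Int.negSucc n) x =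
      (cocycle f μ (n + 1 : ℕ) ((f ^ (-((n + 1 : ℕ) : ℤ))) x))⁻¹ := rfl

lemma cocycle_ne_zero {f : X ≃ₜ X} {μ : X → ℝ} (hμ : ∀ x, μ x ≠ 0) (n : ℤ) (x : X) :
    cocycle f μ n x ≠ 0 := by
  have h : ∀ (n : ℕ) x, cocycle f μ n x ≠ 0 := fun n x =>
    Finset.prod_ne_zero_iff.2 fun k _ => hμ _
  cases n with
  | ofNat n => exact h n x
  | negSucc n => exact inv_ne_zero (h (n + 1) _)

lemma log_abs_cocycle_natCast {f : X ≃ₜ X} {μ : X → ℝ} (hμ : ∀ x, μ x ≠ 0) (n : ℕ) (x : X) :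
    Real.log |cocycle f μ n x| = ∑ k ∈ Finset.range n, Real.log |μ ((f ^ (k : ℤ)) x)| := by
  rw [cocycle_natCast, Finset.abs_prod, Real.log_prod fun k _ => abs_ne_zero.2 (hμ _)]

/-- Negative times follow from positive ones because the bound is uniform in the base point: the
cocycle at time `-n` over `x` is the inverse of the cocycle at time `n` over `f⁻ⁿ x`. -/
lemma uniformRate_log_cocycle {f : X ≃ₜ X} {μ : X → ℝ} (hμ : ∀ x, μ x ≠ 0) {l : ℝ}
    (h : ∀ ε : ℝ, 0 < ε → ∃ N : ℕ, ∀ n : ℕ, N ≤ n → ∀ x,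
      |∑ k ∈ Finset.range n, Real.log |μ ((f ^ (k : ℤ)) x)| - n * l| ≤ ε * n) :
    UniformRate (fun n x => Real.log |cocycle f μ n x|) l := by
  intro ε hε
  obtain ⟨N, hN⟩ := h (ε / 2) (by positivity)
  have hnat : ∀ n : ℕ, N + 1 ≤ n → ∀ x,
      |(1 / (n : ℝ)) * Real.log |cocycle f μ n x| - l| < ε := fun n hn x => by
    have hn0 : (0 : ℝ) < n := by exact_mod_cast (by omega : 0 < n)
    have h1 := hN n (by omega) x
    rw [← log_abs_cocycle_natCast hμ] at h1
    have e : (1 / (n : ℝ)) * Real.log |cocycle f μ n x| - l =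
        (Real.log |cocycle f μ n x| - n * l) / n := by field_simp
    rw [e, abs_div, abs_of_pos hn0, div_lt_iff₀ hn0]
    nlinarith
  filter_upwards [eventually_cofinite_le_abs (N + 1)] with n hn x
  cases n with
  | ofNat n => exact hnat n (by simp at hn; omega) x
  | negSucc n =>
    rw [cocycle_negSucc]
    have h1 := hnat (n + 1) (by rw [Int.abs_eq_natAbs, Int.natAbs_negSucc] at hn; omega)
      ((f ^ (-((n + 1 : ℕ) : ℤ))) x)
    rw [abs_inv, Real.log_inv]
    convert h1 using 3
    rw [Int.cast_negSucc]
    field_simp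

lemma Dpow_eq_cocycle_smul {f : Torus d ≃ₜ Torus d}
    (hf : ∀ x, ∃ A, HasTorusFDerivAt f A x) (hf' : ∀ x, ∃ A, HasTorusFDerivAt f.symm A x)
    {μ : Torus d → ℝ} {e : Torus d → Vec d} (hμ : ∀ x, μ x ≠ 0)
    (he : ∀ x, tderiv f x (e x) = μ x • e (f x)) (n : ℤ) (x : Torus d) :
    Dpow f n x (e x) = cocycle f μ n x • e ((f ^ n) x) := by
  have hnat : ∀ (n : ℕ) x, Dpow f n x (e x) = cocycle f μ n x • e ((f ^ (n : ℤ)) x) := by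
    intro n x
    induction n with
    | zero =>
      rw [cocycle_natCast, Finset.prod_range_zero, one_smul, zpow_zero_apply, Nat.cast_zero,
        Dpow_zero, ContinuousLinearMap.id_apply]
    | succ n ih =>
      rw [zpow_succ_apply, Nat.cast_succ, add_comm, Dpow_add hf hf', Dpow_one,
        ContinuousLinearMap.comp_apply, ih, map_smul, he, smul_smul, add_comm, ← Nat.cast_succ,
        cocycle_natCast, cocycle_natCast, Finset.prod_range_succ]
  cases n with
  | ofNat n => exact hnat n x
  | negSucc n =>
    have h1 := hnat (n + 1) ((f ^ (-((n + 1 : ℕ) : ℤ))) x)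
    rw [zpow_apply_zpow_neg] at h1
    have h2 := Dpow_neg_apply_Dpow hf hf' ((n + 1 : ℕ) : ℤ) ((f ^ (-((n + 1 : ℕ) : ℤ))) x)
      (e ((f ^ (-((n + 1 : ℕ) : ℤ))) x))
    rw [zpow_apply_zpow_neg, h1, map_smul] at h2
    have hneg : Int.negSucc n = -((n + 1 : ℕ) : ℤ) := rfl
    rw [cocycle_negSucc, hneg, ← h2, smul_smul,
      inv_mul_cancel₀ (cocycle_ne_zero hμ _ _), one_smul]

end ScalarCocycle

/-! ### Gram determinants and Jacobians -/

section Gram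

open Matrix

/-- From `⟪T bᵢ, T bⱼ⟫ = ⟪bᵢ, T*T bⱼ⟫`, the Gram matrix of the image is that of `b` times the matrix
of `T*T` in `b`. The basis need not be orthonormal, as suits an invariant frame. -/
lemma det_adjoint_comp_self_mul_det_gram {V W ι : Type*} [NormedAddCommGroup V]
    [InnerProductSpace ℝ V] [CompleteSpace V] [NormedAddCommGroup W] [InnerProductSpace ℝ W]
    [CompleteSpace W] [Fintype ι] [DecidableEq ι] (b : Module.Basis ι ℝ V) (T : V →L[ℝ] W) :
    (ContinuousLinearMap.adjoint T ∘L T).det * (gram ℝ b).det = (gram ℝ fun i => T (b i)).det := by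
  set S : V →ₗ[ℝ] V := ((ContinuousLinearMap.adjoint T ∘L T : V →L[ℝ] V) : V →ₗ[ℝ] V) with hS
  have h : (gram ℝ fun i => T (b i)) = gram ℝ b * LinearMap.toMatrix b b S := by
    ext i j
    rw [gram_apply, Matrix.mul_apply]
    have h1 : S (b j) = ∑ k, (LinearMap.toMatrix b b S k j) • b k := by
      simp only [LinearMap.toMatrix_apply]
      exact (b.sum_repr _).symm
    have h2 : inner ℝ (T (b i)) (T (b j)) = inner ℝ (b i) (S (b j)) := by
      rw [hS]
      exact (ContinuousLinearMap.adjoint_inner_right T (b i) (T (b j))).symm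
    rw [h2, h1, inner_sum]
    refine Finset.sum_congr rfl fun k _ => ?_
    rw [inner_smul_right, gram_apply, mul_comm]
  rw [h, Matrix.det_mul, LinearMap.det_toMatrix, mul_comm]

lemma det_gram_smul {E ι : Type*} [NormedAddCommGroup E] [InnerProductSpace ℝ E] [Fintype ι]
    [DecidableEq ι] (c : ι → ℝ) (v : ι → E) :
    (gram ℝ fun i => c i • v i).det = (∏ i, |c i|) ^ 2 * (gram ℝ v).det := by
  have h : (gram ℝ fun i => c i • v i) = diagonal c * gram ℝ v * diagonal c := by
    ext i j
    rw [mul_diagonal, diagonal_mul, gram_apply, gram_apply, inner_smul_left, inner_smul_right]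
    simp
    ring
  rw [h, det_mul, det_mul, det_diagonal, ← Finset.abs_prod, sq_abs]
  ring

lemma det_gram_pos {E ι : Type*} [NormedAddCommGroup E] [InnerProductSpace ℝ E] [Fintype ι]
    [DecidableEq ι] {v : ι → E} (hv : LinearIndependent ℝ v) : 0 < (gram ℝ v).det :=
  (posDef_gram_of_linearIndependent hv).det_pos

lemma log_sqrt_of_mul_eq {D g g' p : ℝ} (hg : 0 < g) (hg' : 0 < g') (hp : 0 < p)
    (h : D * g = p ^ 2 * g') :
    Real.log (Real.sqrt D) = Real.log p + (Real.log g' - Real.log g) / 2 := by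
  have hD : D = p ^ 2 * g' / g := by rw [← h]; field_simp
  have hD0 : 0 < D := by rw [hD]; positivity
  rw [Real.log_sqrt hD0.le, hD, Real.log_div (by positivity) hg.ne',
    Real.log_mul (by positivity) hg'.ne', Real.log_pow]
  push_cast
  ring

variable {ι : Type*} [Fintype ι] [DecidableEq ι]

/-- The multipliers appear up to Gram determinants of the two frames. For a continuous frame on a
compact space these are bounded and bounded away from zero. -/
lemma log_subJac {A : Vec d →L[ℝ] Vec d} {V : Submodule ℝ (Vec d)} {v w : ι → Vec d} {c : ι → ℝ}
    (hv : LinearIndependent ℝ v) (hw : LinearIndependent ℝ w) (hc : ∀ i, c i ≠ 0)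
    (hV : V = Submodule.span ℝ (Set.range v)) (hA : ∀ i, A (v i) = c i • w i) :
    Real.log (subJac A V) = ∑ i, Real.log |c i| +
      (Real.log (gram ℝ w).det - Real.log (gram ℝ v).det) / 2 := by
  subst hV
  have h := det_adjoint_comp_self_mul_det_gram (Module.Basis.span hv)
    (A ∘L (Submodule.span ℝ (Set.range v)).subtypeL)
  have e1 : gram ℝ (Module.Basis.span hv) = gram ℝ v := by
    ext i j
    rw [gram_apply, gram_apply, Submodule.coe_inner, Module.Basis.span_apply,
      Module.Basis.span_apply]
  have e2 : (fun i => (A ∘L (Submodule.span ℝ (Set.range v)).subtypeL) (Module.Basis.span hv i)) =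
      fun i => c i • w i := by
    funext i
    rw [ContinuousLinearMap.comp_apply, Submodule.subtypeL_apply, Module.Basis.span_apply, hA]
  rw [e1, e2, det_gram_smul] at h
  rw [subJac, log_sqrt_of_mul_eq (det_gram_pos hv) (det_gram_pos hw)
    (Finset.prod_pos fun i _ => abs_pos.2 (hc i)) h,
    Real.log_prod fun i _ => abs_ne_zero.2 (hc i)]

lemma log_abs_det {A : Vec d →L[ℝ] Vec d} {w : ι → Vec d} {c : ι → ℝ}
    (b : Module.Basis ι ℝ (Vec d)) (hw : LinearIndependent ℝ w) (hc : ∀ i, c i ≠ 0)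
    (hA : ∀ i, A (b i) = c i • w i) :
    Real.log |A.det| = ∑ i, Real.log |c i| +
      (Real.log (gram ℝ w).det - Real.log (gram ℝ b).det) / 2 := by
  have h := det_adjoint_comp_self_mul_det_gram b A
  have e : (ContinuousLinearMap.adjoint A ∘L A).det = A.det ^ 2 := by
    rw [← ContinuousLinearMap.normDet_sq]
    have := LinearMap.normDet_eq_abs_det (A : Vec d →ₗ[ℝ] Vec d)
    rw [this]
    simp [ContinuousLinearMap.det]
  rw [e] at h
  simp only [hA] at h
  rw [det_gram_smul] at h
  rw [← Real.sqrt_sq_eq_abs, log_sqrt_of_mul_eq (det_gram_pos b.linearIndependent) (det_gram_pos hw)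
    (Finset.prod_pos fun i _ => abs_pos.2 (hc i)) h,
    Real.log_prod fun i _ => abs_ne_zero.2 (hc i)]

lemma continuous_det_gram {X E : Type*} [TopologicalSpace X] [NormedAddCommGroup E]
    [InnerProductSpace ℝ E] {e : ι → X → E} (he : ∀ i, Continuous (e i)) :
    Continuous fun x => (gram ℝ fun i => e i x).det :=
  Continuous.matrix_det (continuous_matrix fun i j => by
    simp only [gram_apply]
    exact (he i).inner (he j))

end Gram

/-! ### Recognizing stable and unstable vectors by their exponents -/

section Hyperbolic

variable {f : Torus d ≃ₜ Torus d} {Es Eu : Torus d → Submodule ℝ (Vec d)}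

lemma eventually_norm_Dpow_lt_one_of_neg {x : Torus d} {v : Vec d} {χ : ℝ}
    (hv : HasLyapunovExponent f x v χ) (hχ : χ < 0) :
    ∀ᶠ n : ℕ in atTop, ‖Dpow f n x v‖ ≤ 1 := by
  have h := (hv.1.comp tendsto_natCast_atTop_atTop).eventually (gt_mem_nhds hχ)
  filter_upwards [h, eventually_gt_atTop 0] with n hn hn0
  have hn0' : (0 : ℝ) < n := by exact_mod_cast hn0
  simp only [Function.comp_apply, growth, Int.cast_natCast] at hn
  have h1 : Real.log ‖Dpow f n x v‖ < 0 := by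
    by_contra h0
    exact absurd hn (not_lt.2 (mul_nonneg (by positivity) (not_lt.1 h0)))
  by_contra h2
  exact absurd h1 (not_lt.2 (Real.log_nonneg (not_le.1 h2).le))

lemma eventually_norm_Dpow_lt_one_of_pos {x : Torus d} {v : Vec d} {χ : ℝ}
    (hv : HasLyapunovExponent f x v χ) (hχ : 0 < χ) :
    ∀ᶠ n : ℕ in atTop, ‖Dpow f (-(n : ℤ)) x v‖ ≤ 1 := by
  have hlim : Tendsto (fun n : ℕ => -(n : ℤ)) atTop atBot :=
    tendsto_neg_atTop_atBot.comp tendsto_natCast_atTop_atTop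
  have h := (hv.2.comp hlim).eventually (lt_mem_nhds hχ)
  filter_upwards [h, eventually_gt_atTop 0] with n hn hn0
  have hn0' : (0 : ℝ) < n := by exact_mod_cast hn0
  simp only [Function.comp_apply, growth, Int.cast_natCast, Int.cast_neg] at hn
  have h1 : Real.log ‖Dpow f (-(n : ℤ)) x v‖ < 0 := by
    by_contra h0
    refine absurd hn (not_lt.2 (mul_nonpos_of_nonpos_of_nonneg ?_ (not_lt.1 h0)))
    rw [one_div, inv_nonpos]
    linarith
  by_contra h2
  exact absurd h1 (not_lt.2 (Real.log_nonneg (not_le.1 h2).le))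

/-- The forward orbits of `v` and of its stable part are bounded along large times, whereas a
nonzero unstable part would grow like `η ^ n`. -/
lemma IsHyperbolicSplitting.mem_stable (h : IsHyperbolicSplitting f Es Eu) {x : Torus d}
    {v : Vec d} {χ : ℝ} (hv : HasLyapunovExponent f x v χ) (hχ : χ < 0) : v ∈ Es x := by
  obtain ⟨s, hs, u, hu, rfl⟩ := Submodule.mem_sup.1
    ((h.isCompl x).sup_eq_top ▸ Submodule.mem_top : v ∈ Es x ⊔ Eu x)
  obtain ⟨θ, η, C, hθ, hθ1, hη, hC, hr⟩ := h.rates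
  suffices hu0 : u = 0 by rw [hu0, add_zero]; exact hs
  by_contra hu0
  have hpos : 0 < C⁻¹ * ‖u‖ := by have := norm_pos_iff.2 hu0; positivity
  have hlim : Tendsto (fun n : ℕ => C⁻¹ * ‖u‖ * η ^ n) atTop atTop :=
    (tendsto_pow_atTop_atTop_of_one_lt hη).const_mul_atTop hpos
  obtain ⟨n, h1, h2⟩ := ((eventually_norm_Dpow_lt_one_of_neg hv hχ).and
    (hlim.eventually_gt_atTop (1 + C * ‖s‖))).exists
  have h3 := (hr n x).1 u hu
  have h4 := (hr n x).2 s hs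
  have h5 : ‖Dpow f n x u‖ ≤ ‖Dpow f n x (s + u)‖ + ‖Dpow f n x s‖ := by
    rw [map_add]
    simpa using norm_sub_le (Dpow f n x s + Dpow f n x u) (Dpow f n x s)
  have h6 : C * θ ^ n * ‖s‖ ≤ C * 1 * ‖s‖ := by
    gcongr; exact pow_le_one₀ hθ.le hθ1.le
  nlinarith

lemma IsHyperbolicSplitting.mem_unstable (h : IsHyperbolicSplitting f Es Eu)
    (hf : ∀ x, ∃ A, HasTorusFDerivAt f A x) (hf' : ∀ x, ∃ A, HasTorusFDerivAt f.symm A x)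
    {x : Torus d} {v : Vec d} {χ : ℝ} (hv : HasLyapunovExponent f x v χ) (hχ : 0 < χ) :
    v ∈ Eu x := by
  obtain ⟨s, hs, u, hu, rfl⟩ := Submodule.mem_sup.1
    ((h.isCompl x).sup_eq_top ▸ Submodule.mem_top : v ∈ Es x ⊔ Eu x)
  obtain ⟨θ, η, C, hθ, hθ1, hη, hC, hr⟩ := h.rates
  suffices hs0 : s = 0 by rw [hs0, zero_add]; exact hu
  by_contra hs0
  have hlim : Tendsto (fun n : ℕ => C * (1 + C * ‖u‖) * θ ^ n) atTop
      (𝓝 (C * (1 + C * ‖u‖) * 0)) :=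
    (tendsto_pow_atTop_nhds_zero_of_lt_one hθ.le hθ1).const_mul _
  rw [mul_zero] at hlim
  obtain ⟨n, h1, h2⟩ := ((eventually_norm_Dpow_lt_one_of_pos hv hχ).and
    (hlim.eventually (gt_mem_nhds (norm_pos_iff.2 hs0)))).exists
  -- The rates are given for forward time only, so they are applied at `f⁻ⁿ x` to the vectors pulled
  -- back there.
  set y := (f ^ (-(n : ℤ))) x with hy
  have h3 := (hr n y).1 _ (h.invariant_unstable.zpow hf hf' (-(n : ℤ)) x hu)
  have h4 := (hr n y).2 _ (h.invariant_stable.zpow hf hf' (-(n : ℤ)) x hs)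
  rw [hy, Dpow_apply_Dpow_neg hf hf'] at h3 h4
  set un := Dpow f (-(n : ℤ)) x u
  set sn := Dpow f (-(n : ℤ)) x s
  have h5 : ‖sn‖ ≤ ‖Dpow f (-(n : ℤ)) x (s + u)‖ + ‖un‖ := by
    rw [map_add]
    simpa using norm_sub_le (sn + un) un
  have h6 : ‖un‖ ≤ C * ‖u‖ := by
    have h7 : C⁻¹ * 1 * ‖un‖ ≤ C⁻¹ * η ^ n * ‖un‖ := by
      gcongr; exact one_le_pow₀ hη.le
    have := h7.trans h3
    rwa [mul_one, inv_mul_le_iff₀ hC] at this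
  have h8 : C * θ ^ n * ‖sn‖ ≤ C * θ ^ n * (1 + C * ‖u‖) := by
    gcongr; linarith
  nlinarith

end Hyperbolic

/-- By the modular law, `a = (s ⊔ u) ⊓ a = s ⊔ (u ⊓ a)`, and `u ⊓ a` vanishes. This takes the place
of a dimension count. -/
lemma eq_of_le_of_isCompl_of_sup_eq_top {α : Type*} [Lattice α] [BoundedOrder α]
    [IsModularLattice α] {a b s u : α} (h : IsCompl a b) (hs : s ≤ a) (hu : u ≤ b)
    (hsu : s ⊔ u = ⊤) : a = s := by
  have h1 : (s ⊔ u) ⊓ a = s ⊔ u ⊓ a := sup_inf_assoc_of_le u hs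
  have h2 : u ⊓ a = ⊥ := (h.disjoint.symm.mono_left hu).eq_bot
  rwa [hsu, top_inf_eq, h2, sup_bot_eq] at h1

/-! ### Invariant frames -/

/-- A continuous frame `e` of the tangent bundle with `Df e i = μ i • e i`, the exponential rate
of the cocycle generated by `μ i` being `lam i` uniformly. -/
structure IsUniformFrame (f : Torus d ≃ₜ Torus d) (e : Fin d → Torus d → Vec d)
    (μ : Fin d → Torus d → ℝ) (lam : Fin d → ℝ) : Prop where
  continuous : ∀ i, Continuous (e i)
  linearIndependent : ∀ x, LinearIndependent ℝ fun i => e i x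
  ne_zero : ∀ i x, μ i x ≠ 0
  tderiv_apply : ∀ i x, tderiv f x (e i x) = μ i x • e i (f x)
  strictMono : StrictMono lam
  rate : ∀ i, UniformRate (fun n x => Real.log |cocycle f (μ i) n x|) (lam i)

lemma continuousField_span_singleton {e : Torus d → Vec d} (he : Continuous e)
    (h0 : ∀ x, e x ≠ 0) : ContinuousField fun x => Submodule.span ℝ {e x} := by
  refine continuous_clm_apply.2 fun w => ?_
  simp only [Submodule.starProjection_singleton]
  have h1 : ∀ x, ((‖e x‖ ^ 2 : ℝ)) ≠ 0 := fun x => pow_ne_zero 2 (norm_ne_zero_iff.2 (h0 x))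
  exact ((he.inner continuous_const).div (he.norm.pow 2) h1).smul he

namespace IsUniformFrame

variable {f : Torus d ≃ₜ Torus d} {e : Fin d → Torus d → Vec d} {μ : Fin d → Torus d → ℝ}
  {lam : Fin d → ℝ}

lemma vec_ne_zero (h : IsUniformFrame f e μ lam) (i : Fin d) (x : Torus d) : e i x ≠ 0 :=
  (h.linearIndependent x).ne_zero i

lemma finrank_span (h : IsUniformFrame f e μ lam) (i : Fin d) (x : Torus d) :
    Module.finrank ℝ (Submodule.span ℝ {e i x}) = 1 :=
  finrank_span_singleton (h.vec_ne_zero i x)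

lemma invariantField (h : IsUniformFrame f e μ lam) (i : Fin d) :
    InvariantField f fun x => Submodule.span ℝ {e i x} := by
  intro x
  rw [Submodule.map_span, Set.image_singleton]
  have : (tderiv f x : Vec d →ₗ[ℝ] Vec d) (e i x) = μ i x • e i (f x) := h.tderiv_apply i x
  rw [this, Submodule.span_singleton_smul_eq (h.ne_zero i x).isUnit]

/-- The frame as a basis of the tangent space. -/
def basis (h : IsUniformFrame f e μ lam) (x : Torus d) : Module.Basis (Fin d) ℝ (Vec d) :=
  basisOfLinearIndependentOfCardEqFinrank' _ (h.linearIndependent x) (by simp)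

lemma basis_apply (h : IsUniformFrame f e μ lam) (x : Torus d) (i : Fin d) :
    h.basis x i = e i x := by
  simp [basis]

lemma iSup_span (h : IsUniformFrame f e μ lam) (x : Torus d) :
    ⨆ i, Submodule.span ℝ {e i x} = ⊤ := by
  rw [← Submodule.span_range_eq_iSup, ← (h.basis x).span_eq]
  congr 2
  funext i
  exact (h.basis_apply x i).symm

lemma isInternal (h : IsUniformFrame f e μ lam) (x : Torus d) :
    DirectSum.IsInternal fun i => Submodule.span ℝ {e i x} :=
  (DirectSum.isInternal_submodule_iff_iSupIndep_and_iSup_eq_top _).2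
    ⟨(h.linearIndependent x).iSupIndep_span_singleton, h.iSup_span x⟩

lemma log_norm_Dpow (h : IsUniformFrame f e μ lam)
    (hf : ∀ x, ∃ A, HasTorusFDerivAt f A x) (hf' : ∀ x, ∃ A, HasTorusFDerivAt f.symm A x)
    (i : Fin d) (n : ℤ) (x : Torus d) {a : ℝ}
    (ha : a ≠ 0) : Real.log ‖Dpow f n x (a • e i x)‖ =
      Real.log |cocycle f (μ i) n x| + (Real.log |a| + Real.log ‖e i ((f ^ n) x)‖) := by
  have hc := cocycle_ne_zero (f := f) (h.ne_zero i) n x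
  rw [map_smul, Dpow_eq_cocycle_smul hf hf' (h.ne_zero i) (h.tderiv_apply i), norm_smul, norm_smul,
    Real.log_mul (norm_ne_zero_iff.2 ha)
      (mul_ne_zero (norm_ne_zero_iff.2 hc) (norm_ne_zero_iff.2 (h.vec_ne_zero i _))),
    Real.log_mul (norm_ne_zero_iff.2 hc) (norm_ne_zero_iff.2 (h.vec_ne_zero i _)),
    Real.norm_eq_abs, Real.norm_eq_abs]
  ring

lemma hasLyapunovExponent (h : IsUniformFrame f e μ lam)
    (hf : ∀ x, ∃ A, HasTorusFDerivAt f A x) (hf' : ∀ x, ∃ A, HasTorusFDerivAt f.symm A x)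
    (i : Fin d) (x : Torus d) {v : Vec d}
    (hv : v ∈ Submodule.span ℝ {e i x}) (hv0 : v ≠ 0) : HasLyapunovExponent f x v (lam i) := by
  obtain ⟨a, rfl⟩ := Submodule.mem_span_singleton.1 hv
  have ha : a ≠ 0 := fun h0 => hv0 (by rw [h0, zero_smul])
  obtain ⟨C, hC⟩ := exists_abs_log_le (h.continuous i).norm
    fun x => norm_ne_zero_iff.2 (h.vec_ne_zero i x)
  have hr : UniformRate (fun n (_ : Unit) => Real.log ‖Dpow f n x (a • e i x)‖) (lam i) := by
    refine ((h.rate i).comp fun _ : Unit => x).of_bounded_sub (C := |Real.log (|a|)| + C) ?_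
    intro n _
    rw [h.log_norm_Dpow hf hf' i n x ha, add_sub_cancel_left]
    exact (abs_add_le _ _).trans (add_le_add_right (hC _) _)
  have := hr.tendsto ()
  exact ⟨this.mono_left atTop_le_cofinite_int, this.mono_left atBot_le_cofinite_int⟩

lemma uniform_growth (h : IsUniformFrame f e μ lam)
    (hf : ∀ x, ∃ A, HasTorusFDerivAt f A x) (hf' : ∀ x, ∃ A, HasTorusFDerivAt f.symm A x)
    (i : Fin d) {ε : ℝ} (hε : 0 < ε) :
    ∀ᶠ n : ℤ in cofinite, ∀ x, ∀ v ∈ Submodule.span ℝ {e i x}, ‖v‖ = 1 →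
      |growth f x v n - lam i| < ε := by
  obtain ⟨C, hC⟩ := exists_abs_log_le (h.continuous i).norm
    fun x => norm_ne_zero_iff.2 (h.vec_ne_zero i x)
  -- Taking pairs of a point and a unit vector as the parameter makes uniformity in both a single
  -- statement.
  have hr : UniformRate (fun n (y : {y : Torus d × Vec d //
      y.2 ∈ Submodule.span ℝ {e i y.1} ∧ ‖y.2‖ = 1}) => Real.log ‖Dpow f n y.1.1 y.1.2‖)
      (lam i) := by
    refine ((h.rate i).comp fun y : {y : Torus d × Vec d //
      y.2 ∈ Submodule.span ℝ {e i y.1} ∧ ‖y.2‖ = 1} => y.1.1).of_bounded_sub (C := C + C) ?_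
    rintro n ⟨⟨x, v⟩, hv, hv1⟩
    dsimp only at hv hv1 ⊢
    obtain ⟨a, rfl⟩ := Submodule.mem_span_singleton.1 hv
    have ha : a ≠ 0 := fun h0 => by simp [h0] at hv1
    rw [h.log_norm_Dpow hf hf' i n x ha, add_sub_cancel_left]
    have h1 : Real.log |a| = - Real.log ‖e i x‖ := by
      simp only [norm_smul, Real.norm_eq_abs] at hv1
      rw [eq_inv_of_mul_eq_one_left hv1, Real.log_inv]
    rw [h1]
    refine (abs_add_le _ _).trans (add_le_add ?_ (hC _))
    rw [abs_neg]
    exact hC x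
  exact (hr ε hε).mono fun n hn x v hv hv1 => hn ⟨(x, v), hv, hv1⟩

lemma uniformRate_det (h : IsUniformFrame f e μ lam)
    (hf : ∀ x, ∃ A, HasTorusFDerivAt f A x) (hf' : ∀ x, ∃ A, HasTorusFDerivAt f.symm A x) :
    UniformRate (fun n x => Real.log |(Dpow f n x).det|) (∑ i, lam i) := by
  obtain ⟨C, hC⟩ := exists_abs_log_le (continuous_det_gram h.continuous)
    fun x => (det_gram_pos (h.linearIndependent x)).ne'
  refine (UniformRate.sum h.rate Finset.univ).of_bounded_sub (C := (C + C) / 2) fun n x => ?_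
  have hb : (fun i => e i x) = h.basis x := funext fun i => (h.basis_apply x i).symm
  rw [log_abs_det (h.basis x) (h.linearIndependent ((f ^ n) x))
    (fun i => cocycle_ne_zero (f := f) (h.ne_zero i) n x) (fun i => by
      rw [h.basis_apply]
      exact Dpow_eq_cocycle_smul hf hf' (h.ne_zero i) (h.tderiv_apply i) n x),
    add_sub_cancel_left, ← hb, abs_div, abs_two]
  gcongr
  exact (abs_sub _ _).trans (add_le_add (hC _) (hC _))

lemma uniformRate_subJac (h : IsUniformFrame f e μ lam)
    (hf : ∀ x, ∃ A, HasTorusFDerivAt f A x) (hf' : ∀ x, ∃ A, HasTorusFDerivAt f.symm A x)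
    (I : Finset (Fin d)) :
    UniformRate (fun n x => Real.log (subJac (Dpow f n x) (⨆ i ∈ I, Submodule.span ℝ {e i x})))
      (∑ i ∈ I, lam i) := by
  have hli : ∀ x, LinearIndependent ℝ fun i : I => e i x := fun x =>
    (h.linearIndependent x).comp _ Subtype.val_injective
  obtain ⟨C, hC⟩ := exists_abs_log_le (continuous_det_gram fun i : I => h.continuous i)
    fun x => (det_gram_pos (hli x)).ne'
  refine (UniformRate.sum h.rate I).of_bounded_sub (C := (C + C) / 2) fun n x => ?_
  rw [log_subJac (hli x) (hli ((f ^ n) x))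
    (fun i => cocycle_ne_zero (f := f) (h.ne_zero i) n x)
    (by rw [Submodule.span_range_eq_iSup, iSup_subtype])
    (fun i => Dpow_eq_cocycle_smul hf hf' (h.ne_zero i) (h.tderiv_apply i) n x),
    Finset.sum_coe_sort I fun i => Real.log |cocycle f (μ i) n x|,
    add_sub_cancel_left, abs_div, abs_two]
  gcongr
  exact (abs_sub _ _).trans (add_le_add (hC _) (hC _))

lemma isOseledetsSplitting (h : IsUniformFrame f e μ lam)
    (hf : ∀ x, ∃ A, HasTorusFDerivAt f A x) (hf' : ∀ x, ∃ A, HasTorusFDerivAt f.symm A x)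
    (x : Torus d) :
    IsOseledetsSplitting f x lam fun i => Submodule.span ℝ {e i x} := by
  have hdet := (h.uniformRate_det hf hf').tendsto x
  have hsum : (∑ i, (Module.finrank ℝ (Submodule.span ℝ {e i x}) : ℝ) * lam i) = ∑ i, lam i := by
    refine Finset.sum_congr rfl fun i _ => ?_
    rw [h.finrank_span, Nat.cast_one, one_mul]
  exact
    { strictMono := h.strictMono
      ne_bot := fun i => by
        rw [Ne, Submodule.span_singleton_eq_bot]
        exact h.vec_ne_zero i x
      isInternal := h.isInternal x
      exponent := fun i v hv hv0 => h.hasLyapunovExponent hf hf' i x hv hv0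
      det_atTop := by rw [hsum]; exact hdet.mono_left atTop_le_cofinite_int
      det_atBot := by rw [hsum]; exact hdet.mono_left atBot_le_cofinite_int }

lemma stable_unstable_eq (h : IsUniformFrame f e μ lam)
    (hf : ∀ x, ∃ A, HasTorusFDerivAt f A x) (hf' : ∀ x, ∃ A, HasTorusFDerivAt f.symm A x)
    (hlam : ∀ i, lam i ≠ 0)
    {Es Eu : Torus d → Submodule ℝ (Vec d)} (hs : IsHyperbolicSplitting f Es Eu) (x : Torus d) :
    Es x = (⨆ i, ⨆ _ : lam i < 0, Submodule.span ℝ {e i x}) ∧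
      Eu x = (⨆ i, ⨆ _ : 0 < lam i, Submodule.span ℝ {e i x}) := by
  set S := ⨆ i, ⨆ _ : lam i < 0, Submodule.span ℝ {e i x} with hS
  set U := ⨆ i, ⨆ _ : 0 < lam i, Submodule.span ℝ {e i x} with hU
  have hexp : ∀ i, HasLyapunovExponent f x (e i x) (lam i) := fun i =>
    h.hasLyapunovExponent hf hf' i x (Submodule.mem_span_singleton_self _) (h.vec_ne_zero i x)
  have h1 : S ≤ Es x := iSup₂_le fun i hi => by
    rw [Submodule.span_singleton_le_iff_mem]
    exact hs.mem_stable (hexp i) hi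
  have h2 : U ≤ Eu x := iSup₂_le fun i hi => by
    rw [Submodule.span_singleton_le_iff_mem]
    exact hs.mem_unstable hf hf' (hexp i) hi
  have h3 : S ⊔ U = ⊤ := by
    rw [eq_top_iff, ← h.iSup_span x]
    refine iSup_le fun i => ?_
    rcases lt_or_gt_of_ne (hlam i) with hi | hi
    · exact le_sup_of_le_left (le_iSup₂_of_le i hi le_rfl)
    · exact le_sup_of_le_right (le_iSup₂_of_le i hi le_rfl)
  exact ⟨eq_of_le_of_isCompl_of_sup_eq_top (hs.isCompl x) h1 h2 h3,
    eq_of_le_of_isCompl_of_sup_eq_top (hs.isCompl x).symm h2 h1 (by rw [sup_comm, h3])⟩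

end IsUniformFrame

/-! ### Frames of perturbations of a hyperbolic linear map -/

section Perturbation

variable {M : Matrix (Fin d) (Fin d) ℤ} {β : Fin d → ℝ} {b : Module.Basis (Fin d) ℝ (Vec d)}
  {f : Torus d ≃ₜ Torus d}

/-- The off-diagonal row sums are at most `d / (d + 1) < 1`, so the matrix is strictly diagonally
dominant. -/
lemma linearIndependent_of_diagonally_dominant {u : Fin d → Fin d → ℝ}
    (h1 : ∀ i, u i i = 1) (h2 : ∀ i j, j ≠ i → |u i j| ≤ 1 / (d + 1)) :
    LinearIndependent ℝ u := by
  have hdet : (Matrix.of u).det ≠ 0 := by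
    refine det_ne_zero_of_sum_row_lt_diag fun i => ?_
    rw [Matrix.of_apply, h1, norm_one]
    calc _ ≤ ∑ _j ∈ Finset.univ.erase i, (1 / (d + 1) : ℝ) :=
          Finset.sum_le_sum fun j hj => h2 i j (Finset.ne_of_mem_erase hj)
      _ ≤ ∑ _j : Fin d, (1 / (d + 1) : ℝ) :=
          Finset.sum_le_sum_of_subset_of_nonneg (Finset.erase_subset _ _)
            fun _ _ _ => by positivity
      _ = d / (d + 1) := by simp [div_eq_mul_inv]
      _ < 1 := by rw [div_lt_one (by positivity)]; linarith
  exact Matrix.linearIndependent_rows_of_det_ne_zero hdet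

/-- The section lemma is used for every `i` with `ρ = 1 / (d + 1)`, the size that makes the sections
independent; this explains the factor `d + 1` in `h6`. The multiplier is the `i`-th coordinate of
the image of a vector whose `i`-th coordinate is `1` and whose norm is at most `1`, hence its
distance to `β i`. -/
lemma exists_invariant_frame {δ ε g B : ℝ} (hcont : Continuous (tderiv f)) (hc : C1Close δ f M)
    (hb : ∀ i, linCLM M (b i) = β i • b i)
    (hδε : ‖(b.equivFunL : Vec d →L[ℝ] (Fin d → ℝ))‖ * δ *
      ‖(b.equivFunL.symm : (Fin d → ℝ) →L[ℝ] Vec d)‖ ≤ ε)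
    (hε : 0 ≤ ε) (hg : 0 < g) (hgap : ∀ i j, j ≠ i → g ≤ |(|β j| - |β i|)|)
    (hB : ∀ j, |β j| ≤ B) (hβ0 : ∀ j, β j ≠ 0) (h6 : 6 * (d + 1) * ε ≤ g) :
    ∃ (e : Fin d → Torus d → Vec d) (μ : Fin d → Torus d → ℝ),
      (∀ i, Continuous (e i)) ∧ (∀ i, Continuous (μ i)) ∧
      (∀ x, LinearIndependent ℝ fun i => e i x) ∧
      (∀ i x, tderiv f x (e i x) = μ i x • e i (f x)) ∧ ∀ i x, |μ i x - β i| ≤ ε := by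
  set Φ := b.equivFunL
  set P : C(Torus d, (Fin d → ℝ) →L[ℝ] (Fin d → ℝ)) :=
    ⟨fun x => (Φ : Vec d →L[ℝ] (Fin d → ℝ)) ∘L (tderiv f x - linCLM M) ∘L
      (Φ.symm : (Fin d → ℝ) →L[ℝ] Vec d),
      continuous_const.clm_comp ((hcont.sub continuous_const).clm_comp continuous_const)⟩ with hPdef
  have hPapp : ∀ x c, P x c = Φ (tderiv f x (Φ.symm c)) - Φ (linCLM M (Φ.symm c)) := by
    intro x c
    rw [← map_sub]
    rfl
  have hP : ∀ x, ‖P x‖ ≤ ε := fun x => by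
    refine le_trans ?_ hδε
    have h0 := (hc x).2.le
    calc _ ≤ ‖(Φ : Vec d →L[ℝ] (Fin d → ℝ))‖ * ‖(tderiv f x - linCLM M) ∘L
          (Φ.symm : (Fin d → ℝ) →L[ℝ] Vec d)‖ := ContinuousLinearMap.opNorm_comp_le _ _
      _ ≤ ‖(Φ : Vec d →L[ℝ] (Fin d → ℝ))‖ * (‖tderiv f x - linCLM M‖ *
          ‖(Φ.symm : (Fin d → ℝ) →L[ℝ] Vec d)‖) :=
          mul_le_mul_of_nonneg_left (ContinuousLinearMap.opNorm_comp_le _ _) (norm_nonneg _)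
      _ ≤ ‖(Φ : Vec d →L[ℝ] (Fin d → ℝ))‖ * (δ *
          ‖(Φ.symm : (Fin d → ℝ) →L[ℝ] Vec d)‖) :=
          mul_le_mul_of_nonneg_left (mul_le_mul_of_nonneg_right h0 (norm_nonneg _)) (norm_nonneg _)
      _ = _ := by ring
  have hd0 : (0 : ℝ) ≤ d := Nat.cast_nonneg d
  have hρ : (1 / (d + 1) : ℝ) ≤ 1 := by rw [div_le_one (by positivity)]; linarith
  have hdε : 0 ≤ d * ε := by positivity
  have h2 : 2 * ε ≤ 1 / (d + 1) * g := by
    rw [div_mul_eq_mul_div, le_div_iff₀ (by positivity)]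
    nlinarith
  choose u hu hinv using fun i => exists_invariant_section f β P i hg hε
    (by positivity : (0 : ℝ) ≤ 1 / (d + 1)) hρ (hgap i) hB hβ0 (by nlinarith) h2 hP
  have hu1 : ∀ i x, ‖u i x‖ ≤ 1 := fun i x => by
    refine (pi_norm_le_iff_of_nonneg zero_le_one).2 fun j => ?_
    by_cases hj : j = i
    · rw [hj, (hu i x).1, norm_one]
    · exact ((hu i x).2 j hj).trans hρ
  refine ⟨fun i x => Φ.symm (u i x), fun i x => β i + P x (u i x) i,
    fun i => Φ.symm.continuous.comp (u i).continuous,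
    fun i => continuous_const.add
      ((continuous_apply i).comp (P.continuous.clm_apply (u i).continuous)),
    fun x => ?_, fun i x => ?_, fun i x => ?_⟩
  · exact (linearIndependent_of_diagonally_dominant (fun i => (hu i x).1) fun i => (hu i x).2).map'
      (Φ.symm : (Fin d → ℝ) →ₗ[ℝ] Vec d) (LinearEquiv.ker Φ.symm.toLinearEquiv)
  · apply Φ.injective
    rw [map_smul, Φ.apply_symm_apply]
    funext j
    have h := hinv i x j
    rw [Pi.smul_apply, smul_eq_mul, ← h, hPapp, Pi.sub_apply, equivFunL_linCLM hb,
      Φ.apply_symm_apply]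
    ring
  · rw [add_sub_cancel_left]
    calc _ ≤ ‖P x (u i x)‖ := norm_le_pi_norm (P x (u i x)) i
      _ ≤ ‖P x‖ * ‖u i x‖ := (P x).le_opNorm _
      _ ≤ ε * 1 := mul_le_mul (hP x) (hu1 i x) (norm_nonneg _) hε
      _ = ε := mul_one ε

/-- Constant periodic data force the multipliers along an invariant frame with separated rates to
agree at periodic points. -/
lemma abs_cocycle_eq_of_periodic (hf : ∀ x, ∃ A, HasTorusFDerivAt f A x)
    (hf' : ∀ x, ∃ A, HasTorusFDerivAt f.symm A x) (hper : HasConstantPeriodicData f)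
    {e : Fin d → Torus d → Vec d} {μ : Fin d → Torus d → ℝ} {l r : Fin d → ℝ}
    (hli : ∀ x, LinearIndependent ℝ fun i => e i x)
    (he : ∀ i x, tderiv f x (e i x) = μ i x • e i (f x)) (hl : ∀ i, 0 < l i)
    (hlμ : ∀ i x, l i ≤ |μ i x|) (hμr : ∀ i x, |μ i x| ≤ r i)
    (hsep : ∀ i j, j ≠ i → r i < l j ∨ r j < l i) {p q : Torus d} {n : ℕ} (hn : 0 < n)
    (hp : (f ^ (n : ℤ)) p = p) (hq : (f ^ (n : ℤ)) q = q) (i : Fin d) :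
    |cocycle f (μ i) n p| = |cocycle f (μ i) n q| := by
  have hμ0 : ∀ i x, μ i x ≠ 0 := fun i x => abs_pos.1 ((hl i).trans_le (hlμ i x))
  have hlow : ∀ i x, l i ^ n ≤ |cocycle f (μ i) n x| := fun i x => by
    rw [cocycle_natCast, Finset.abs_prod]
    calc l i ^ n = ∏ _k ∈ Finset.range n, l i := by simp
      _ ≤ _ := Finset.prod_le_prod (fun _ _ => (hl i).le) fun k _ => hlμ i _
  have hup : ∀ i x, |cocycle f (μ i) n x| ≤ r i ^ n := fun i x => by
    rw [cocycle_natCast, Finset.abs_prod]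
    calc _ ≤ ∏ _k ∈ Finset.range n, r i :=
          Finset.prod_le_prod (fun _ _ => abs_nonneg _) fun k _ => hμr i _
      _ = r i ^ n := by simp
  have hr : ∀ i, 0 ≤ r i := fun i => (abs_nonneg _).trans (hμr i p)
  obtain ⟨S, hS⟩ := hper p q n hp hq
  set bq : Module.Basis (Fin d) ℝ (Vec d) :=
    basisOfLinearIndependentOfCardEqFinrank' _ (hli q) (by simp) with hbq
  have hbq' : ∀ k, (Dpow f n q : Vec d →ₗ[ℝ] Vec d) (bq k) = cocycle f (μ k) n q • bq k := by
    intro k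
    have h1 := Dpow_eq_cocycle_smul hf hf' (hμ0 k) (he k) n q
    rw [hq] at h1
    simpa [hbq] using h1
  have h1 := Dpow_eq_cocycle_smul hf hf' (hμ0 i) (he i) n p
  rw [hp] at h1
  have h2 := hS (e i p)
  rw [h1, map_smul] at h2
  have h3 : S (e i p) ≠ 0 := fun h0 => (hli p).ne_zero i (S.injective (by rw [h0, map_zero]))
  -- `S (e i p)` is an eigenvector of `Dfⁿ(q)`; any nonzero coordinate in the eigenbasis at `q`
  -- identifies its eigenvalue.
  obtain ⟨k, hk⟩ : ∃ k, bq.repr (S (e i p)) k ≠ 0 := by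
    by_contra hall
    push Not at hall
    exact h3 (bq.repr.injective (Finsupp.ext fun k => by rw [hall k, map_zero]; rfl))
  have h4 := repr_apply_of_eigenbasis bq (Dpow f n q : Vec d →ₗ[ℝ] Vec d) hbq' (S (e i p)) k
  have h5 : bq.repr (Dpow f n q (S (e i p))) k = cocycle f (μ i) n p * bq.repr (S (e i p)) k := by
    rw [← h2, map_smul]; rfl
  have h6 : cocycle f (μ i) n p = cocycle f (μ k) n q :=
    mul_right_cancel₀ hk (h5.symm.trans h4)
  by_cases hki : k = i
  · rw [h6, hki]
  -- For `k ≠ i` the common value would have its modulus in both `[l i ^ n, r i ^ n]` and `[l k ^ n,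
  -- r k ^ n]`, which are disjoint.
  exfalso
  have a1 := hlow i p
  have a2 := hup i p
  rw [h6] at a1 a2
  rcases hsep i k hki with hlt | hlt
  · exact absurd ((hlow k q).trans a2) (not_le.2 (pow_lt_pow_left₀ hlt (hr i) hn.ne'))
  · exact absurd (a1.trans (hup k q)) (not_le.2 (pow_lt_pow_left₀ hlt (hr k) hn.ne'))

lemma exists_gap (hβ : StrictMono fun i => |β i|) (hβ0 : ∀ i, β i ≠ 0) (hβ1 : ∀ i, |β i| ≠ 1) :
    ∃ g : ℝ, 0 < g ∧ (∀ i j, j ≠ i → g ≤ |(|β j| - |β i|)|) ∧ (∀ i, g ≤ |(|β i| - 1)|) ∧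
      ∀ i, g ≤ |β i| := by
  have hle : ∀ c : ℝ, 0 < c → ∀ᶠ g in 𝓝[>] (0 : ℝ), g ≤ c := fun c hc =>
    (eventually_le_nhds hc).filter_mono nhdsWithin_le_nhds
  have h1 : ∀ᶠ g in 𝓝[>] (0 : ℝ), ∀ i j, j ≠ i → g ≤ |(|β j| - |β i|)| := by
    simp only [eventually_all]
    intro i j hij
    exact hle _ (abs_pos.2 (sub_ne_zero.2 fun h => hij (hβ.injective h)))
  have h2 : ∀ᶠ g in 𝓝[>] (0 : ℝ), ∀ i, g ≤ |(|β i| - 1)| := by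
    rw [eventually_all]
    exact fun i => hle _ (abs_pos.2 (sub_ne_zero.2 (hβ1 i)))
  have h3 : ∀ᶠ g in 𝓝[>] (0 : ℝ), ∀ i, g ≤ |β i| := by
    rw [eventually_all]
    exact fun i => hle _ (abs_pos.2 (hβ0 i))
  obtain ⟨g, hg, h⟩ := (eventually_mem_nhdsWithin.and (h1.and (h2.and h3))).exists
  exact ⟨g, hg, h⟩

/-- A perturbation of a hyperbolic linear map with real eigenvalues of distinct moduli that has
constant periodic data carries a uniform frame. -/
lemma exists_uniformFrame (hb : ∀ i, linCLM M (b i) = β i • b i) (hβ : StrictMono fun i => |β i|)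
    (hβ0 : ∀ i, β i ≠ 0) (hβ1 : ∀ i, |β i| ≠ 1) :
    ∃ δ : ℝ, 0 < δ ∧ ∀ f : Torus d ≃ₜ Torus d, (∀ x, ∃ A, HasTorusFDerivAt f A x) →
      (∀ x, ∃ A, HasTorusFDerivAt f.symm A x) → Continuous (tderiv f) → C1Close δ f M →
      HasConstantPeriodicData f → ∃ e μ lam, IsUniformFrame f e μ lam ∧
        (∀ i, |β i| < 1 → lam i < 0) ∧ ∀ i, 1 < |β i| → 0 < lam i := by
  obtain ⟨g, hg, hgap, hg1, hg0⟩ := exists_gap hβ hβ0 hβ1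
  obtain ⟨B, hB⟩ : ∃ B, ∀ j, |β j| ≤ B := by
    refine ⟨∑ j, |β j|, fun j => ?_⟩
    exact Finset.single_le_sum (f := fun j => |β j|) (fun _ _ => abs_nonneg _) (Finset.mem_univ j)
  set ε : ℝ := g / (6 * (d + 1)) with hεdef
  have hε : 0 < ε := by positivity
  have h6 : 6 * (d + 1) * ε = g := by rw [hεdef]; field_simp
  have hd0 : (0 : ℝ) ≤ d * ε := by positivity
  have h6' : 6 * ε ≤ g := by nlinarith
  -- The first entry serves the contracting directions, where `|β i| ≤ 1 - g`, the second the
  -- expanding ones, where `|β i| ≥ 1 + g`; both use `ε ≤ g / 2`.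
  set κ : ℝ := max (1 - g / 2) ((1 + g / 2) / (1 + g)) with hκdef
  have hκ0 : 0 ≤ κ := le_max_of_le_right (by positivity)
  have hκ1 : κ < 1 := max_lt (by linarith) (by rw [div_lt_one (by positivity)]; linarith)
  have hs : ∀ i, |β i| < 1 → |β i| + ε ≤ κ := fun i hi => by
    have h1 := hg1 i
    rw [abs_of_neg (by linarith)] at h1
    refine le_max_of_le_left ?_
    linarith
  have hu' : ∀ i, ¬ |β i| < 1 → 1 + g ≤ |β i| := fun i hi => by
    have h1 := hg1 i
    rw [abs_of_nonneg (by linarith)] at h1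
    linarith
  have hu : ∀ i, ¬ |β i| < 1 → 1 + ε ≤ κ * |β i| := fun i hi => by
    have h2 : (1 + g / 2) / (1 + g) ≤ κ := le_max_right _ _
    calc 1 + ε ≤ 1 + g / 2 := by linarith
      _ = (1 + g / 2) / (1 + g) * (1 + g) := by field_simp
      _ ≤ κ * |β i| := by gcongr; exact hu' i hi
  set F := ‖(b.equivFunL : Vec d →L[ℝ] (Fin d → ℝ))‖ with hF
  set G := ‖(b.equivFunL.symm : (Fin d → ℝ) →L[ℝ] Vec d)‖ with hG
  have hF0 : 0 ≤ F := norm_nonneg _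
  have hG0 : 0 ≤ G := norm_nonneg _
  -- `1 / 4` is for the global lift; the other bound makes the perturbation at most `ε` in
  -- eigenbasis coordinates.
  set δ : ℝ := min (1 / 4) (ε / (F * G + 1)) with hδdef
  have hδ0 : 0 < δ := lt_min (by norm_num) (by positivity)
  have hδε : F * δ * G ≤ ε := by
    have h1 : δ * (F * G + 1) ≤ ε := by
      rw [← le_div_iff₀ (by positivity)]
      exact min_le_right _ _
    nlinarith
  refine ⟨δ, hδ0, fun f hf hf' hcont hc hper => ?_⟩
  obtain ⟨e, μ, hec, hμc, hli, heμ, hμβ⟩ := exists_invariant_frame hcont hc hb hδε hε.le hg hgap hB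
    hβ0 h6.le
  obtain ⟨R, hR, hclose⟩ := exists_periodic_shadowing (min_le_left _ _) hf hc hb hδε hε.le hκ0 hκ1
    hs hu
  have hlμ : ∀ i x, |β i| - ε ≤ |μ i x| := fun i x => by
    have := abs_sub_abs_le_abs_sub (β i) (μ i x)
    rw [abs_sub_comm] at this
    linarith [hμβ i x]
  have hμr : ∀ i x, |μ i x| ≤ |β i| + ε := fun i x => by
    linarith [abs_sub_abs_le_abs_sub (μ i x) (β i), hμβ i x]
  have hl : ∀ i, 0 < |β i| - ε := fun i => by linarith [hg0 i]
  have hsep : ∀ i j, j ≠ i → |β i| + ε < |β j| - ε ∨ |β j| + ε < |β i| - ε := fun i j hij => by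
    have h1 := hgap i j hij
    rcases le_abs.1 h1 with h | h
    · left; linarith
    · right; linarith
  have hμ0 : ∀ i x, μ i x ≠ 0 := fun i x => abs_pos.1 ((hl i).trans_le (hlμ i x))
  -- Closing a segment of length `1` gives a fixed point. It has every period, so it can be compared
  -- with all periodic points.
  obtain ⟨p₀, hp₀, -⟩ := hclose 0 1 one_pos
  have hfix : ∀ k : ℕ, (f ^ (k : ℤ)) p₀ = p₀ := fun k => by
    induction k with
    | zero => exact zpow_zero_apply f p₀
    | succ k ih =>
      rw [zpow_succ_apply, ih]
      simpa using hp₀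
  refine ⟨e, μ, fun i => Real.log |μ i p₀|, ⟨hec, hli, hμ0, heμ, fun i j hij => ?_, fun i => ?_⟩,
    fun i hi => ?_, fun i hi => ?_⟩
  · refine Real.log_lt_log (abs_pos.2 (hμ0 i p₀)) ?_
    have h1 : |β i| < |β j| := hβ hij
    rcases hsep i j hij.ne' with h | h
    · linarith [hμr i p₀, hlμ j p₀]
    · linarith
  · refine uniformRate_log_cocycle (hμ0 i) fun η hη => ?_
    refine birkhoff_uniform_of_periodic f hκ0 hκ1 hclose
      ((hμc i).abs.log fun x => abs_ne_zero.2 (hμ0 i x)) (fun p n hn hp => ?_) hη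
    rw [← log_abs_cocycle_natCast (hμ0 i), abs_cocycle_eq_of_periodic hf hf' hper hli heμ hl hlμ hμr
      hsep hn hp (hfix n) i, log_abs_cocycle_natCast (hμ0 i)]
    simp only [hfix, Finset.sum_const, Finset.card_range, nsmul_eq_mul]
  · refine Real.log_neg (abs_pos.2 (hμ0 i p₀)) ?_
    linarith [hμr i p₀, hs i hi]
  · refine Real.log_pos ?_
    linarith [hlμ i p₀, hu' i hi.not_gt]

end Perturbation

/-! ### Eigenvalues of Anosov matrices -/

/-- Zero is excluded by the unit determinant. For modulus one, the real eigenvector is complexified,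
since hyperbolicity is stated for the complex spectrum. -/
lemma IsAnosovMatrix.eigenvalue_ne {M : Matrix (Fin d) (Fin d) ℤ} (hM : IsAnosovMatrix M)
    {v : Fin d → ℝ} {t : ℝ} (hv : v ≠ 0) (h : (realMatrix M).mulVec v = t • v) :
    t ≠ 0 ∧ |t| ≠ 1 := by
  constructor
  · rintro rfl
    have h1 : (realMatrix M).det = 0 :=
      Matrix.exists_mulVec_eq_zero_iff.1 ⟨v, hv, by rw [h, zero_smul]⟩
    have h2 : (realMatrix M).det = (M.det : ℝ) := ((Int.castRingHom ℝ).map_det M).symm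
    rw [h2, Int.cast_eq_zero] at h1
    have := hM.1
    rw [h1] at this
    exact not_isUnit_zero this
  · intro ht
    refine hM.2 (t : ℂ) ?_ (by rw [Complex.norm_real, Real.norm_eq_abs, ht])
    rw [← Matrix.spectrum_toLin', ← Module.End.hasEigenvalue_iff_mem_spectrum]
    refine Module.End.hasEigenvalue_of_hasEigenvector (x := fun i => (v i : ℂ)) ⟨?_, ?_⟩
    · rw [Module.End.mem_eigenspace_iff, Matrix.toLin'_apply]
      funext i
      have h3 := congrFun h i
      simp only [Matrix.mulVec, dotProduct, realMatrix, Matrix.map_apply, Pi.smul_apply,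
        smul_eq_mul] at h3 ⊢
      exact_mod_cast congrArg (fun a : ℝ => (a : ℂ)) h3
    · intro h0
      exact hv (funext fun i => Complex.ofReal_eq_zero.1 (congrFun h0 i))

end TorusAnosov
end

/-! ### From the uniform frame to the Oseledets splitting -/

open TorusAnosov in
theorem mainTheorem3 {d : ℕ} (M : Matrix (Fin d) (Fin d) ℤ) (hM : IsAnosovMatrix M)
    -- `M` is diagonalizable over `ℝ`, its eigenvalues ordered by their distinct absolute values
    (b : Module.Basis (Fin d) ℝ (Fin d → ℝ)) (β : Fin d → ℝ)
    (hb : ∀ i, (realMatrix M).mulVec (b i) = β i • b i)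
    (hβ : StrictMono fun i => |β i|) :
    ∃ δ : ℝ, 0 < δ ∧ ∀ (α : ℝ≥0) (f : Torus d ≃ₜ Torus d), 0 < α → α ≤ 1 →
      IsC1HolderDiffeo α f → IsAnosov f → C1Close δ f M → HasConstantPeriodicData f →
      -- every point is regular
      (∀ x, IsRegularPoint f x) ∧
      -- the line bundles `E i` and the exponents `lam i`, the latter the same at all points
      ∃ (E : Fin d → Torus d → Submodule ℝ (Vec d)) (lam : Fin d → ℝ),
        (∀ i, ContinuousField (E i) ∧ InvariantField f (E i)) ∧
        (∀ i x, Module.finrank ℝ (E i x) = 1) ∧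
        (∀ x, IsOseledetsSplitting f x lam fun i => E i x) ∧
        -- they split the stable and the unstable bundle of `f`, as for `M`
        (∀ i, lam i < 0 ↔ |β i| < 1) ∧ (∀ i, 0 < lam i ↔ 1 < |β i|) ∧
        (∀ Es Eu, IsHyperbolicSplitting f Es Eu → ∀ x,
          Es x = (⨆ i, ⨆ _ : lam i < 0, E i x) ∧ Eu x = (⨆ i, ⨆ _ : 0 < lam i, E i x)) ∧
        -- the exponents at any point `x` are those of any periodic point `p`
        (∀ p ∈ Function.periodicPts f, ∀ x i, ∀ v ∈ E i p, v ≠ 0 → ∀ w ∈ E i x, w ≠ 0 →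
          ∃ χ, HasLyapunovExponent f p v χ ∧ HasLyapunovExponent f x w χ) ∧
        -- the limits are uniform, for vectors and for the Jacobians on sums of the `E i`
        (∀ ε : ℝ, 0 < ε → ∃ N : ℕ, ∀ n : ℤ, (N : ℤ) ≤ |n| → ∀ x,
          (∀ i, ∀ v ∈ E i x, ‖v‖ = 1 → |growth f x v n - lam i| < ε) ∧
          ∀ I : Finset (Fin d),
            |(1 / (n : ℝ)) * Real.log (subJac (Dpow f n x) (⨆ i ∈ I, E i x))
              - ∑ i ∈ I, lam i| < ε) := by
  have hev : ∀ i, β i ≠ 0 ∧ |β i| ≠ 1 := fun i => hM.eigenvalue_ne (b.ne_zero i) (hb i)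
  set b' : Module.Basis (Fin d) ℝ (Vec d) := b.map (WithLp.linearEquiv 2 ℝ (Fin d → ℝ)).symm
  have hb' : ∀ i, linCLM M (b' i) = β i • b' i := fun i => by
    have h1 : b' i = WithLp.toLp 2 (b i) := by simp [b']
    rw [h1]
    ext j
    have h2 := congrFun (hb i) j
    simpa using h2
  obtain ⟨δ, hδ, H⟩ := exists_uniformFrame hb' hβ (fun i => (hev i).1) fun i => (hev i).2
  refine ⟨δ, hδ, fun α f hα _ hC1 _ hclose hper => ?_⟩
  obtain ⟨⟨hf, K, hK⟩, hf', -⟩ := hC1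
  obtain ⟨e, μ, lam, hframe, hneg, hpos⟩ := H f hf hf' (hK.continuous hα) hclose hper
  -- No `|β i|` equals `1`, so the two one-sided implications for the frame exclude each other and
  -- yield equivalences.
  have hneg' : ∀ i, lam i < 0 ↔ |β i| < 1 := fun i => by
    refine ⟨fun h => ?_, hneg i⟩
    by_contra h1
    linarith [hpos i (lt_of_le_of_ne (not_lt.1 h1) (hev i).2.symm)]
  have hpos' : ∀ i, 0 < lam i ↔ 1 < |β i| := fun i => by
    refine ⟨fun h => ?_, hpos i⟩
    by_contra h1
    linarith [hneg i (lt_of_le_of_ne (not_lt.1 h1) (hev i).2)]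
  have hlam : ∀ i, lam i ≠ 0 := fun i => by
    rcases lt_or_gt_of_ne (hev i).2 with h | h
    · exact (hneg i h).ne
    · exact (hpos i h).ne'
  have hOs := hframe.isOseledetsSplitting hf hf'
  refine ⟨fun x => ⟨d, lam, _, hOs x⟩, fun i x => Submodule.span ℝ {e i x}, lam, fun i =>
    ⟨continuousField_span_singleton (hframe.continuous i) (hframe.vec_ne_zero i),
      hframe.invariantField i⟩, hframe.finrank_span, hOs, hneg', hpos',
    fun Es Eu hs x => hframe.stable_unstable_eq hf hf' hlam hs x,
    fun p _ x i v hv hv0 w hw hw0 => ⟨lam i, hframe.hasLyapunovExponent hf hf' i p hv hv0,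
      hframe.hasLyapunovExponent hf hf' i x hw hw0⟩, fun ε hε => ?_⟩
  refine exists_nat_of_eventually_cofinite ?_
  filter_upwards [eventually_all.2 fun i => hframe.uniform_growth hf hf' i hε,
    eventually_all.2 fun I => hframe.uniformRate_subJac hf hf' I ε hε] with n h1 h2 x
  exact ⟨fun i v hv hv1 => h1 i x v hv hv1, fun I => h2 I x⟩
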